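/- Let $G=(V_1,V_2,E,w)$ be a 1-weighted two-player game structure: $(V,E)$ is a finite non-empty directed graph without deadlocks, $V=V_1\uplus V_2$ (vertices of player 1 and of player 2), $w:E\to\mathbb Z$, and $W=\max_{e\in E}|w(e)|$. Let $U\subseteq V$ and let $\lambda\ge 1$ be an integer. For a play $\rho=\rho_0\rho_1\dots$ put $\mathsf{TP}(\rho_k\dots\rho_m)=\sum_{i=k}^{m-1}w(\rho_i,\rho_{i+1})$. The objective of player 1 is $\Omega=\mathsf{WMP}(\lambda,0)\cap\mathsf{CoBuchi}(U)$: for every $k\ge 0$ there is $l\in\{1,\dots,\lambda\}$ with $\frac1l\mathsf{TP}(\rho_k\dots\rho_{k+l})\ge 0$, and no vertex of $V\setminus U$ is visited infinitely often. The objective of player 2 is the complement $\overline\Omega$ in the set of plays. $\mathrm{Win}_p(\cdot)$ is the set of vertices from which player $p$ has a winning strategy. The window at $k$ is *inductively closed* in $m$ if $k<m\le k+\lambda$ and $\mathsf{TP}(\rho_{k'}\dots\rho_m)\ge 0$ for all $k\le k'<m$. A history $\rho_0\dots\rho_l$ has a *good decomposition* if there are $0=k_0<\dots<k_j=l$ (with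 $j\geq 0$) such that each window at $k_i$ is inductively closed in $k_{i+1}$. For $X,Z\subseteq V$ let - $\mathsf{GDReach}(X)$: some history $\rho_0\dots\rho_l$, $l\ge0$, has a good decomposition and $\rho_l\in X$; - $\mathsf{End}^\lambda(U,X,Z)$: for some $l\in\{1,\dots,\lambda\}$ the window at $0$ is inductively closed in $l$ and either $\rho_l\in \mathrm{Win}_1(\mathsf{GDReach}(X))$, or $\rho_l\in Z$ and $\rho_0,\dots,\rho_l\in U$; - $\mathsf F^\lambda(U,X)$: all vertices are in $U$ and $\rho\in\mathsf{WMP}(\lambda,0)$, or $\rho\in\mathsf{GDReach}(X)$. Algorithm $\mathsf{ObjF}(X)$ starts with $Z_0=V$ and iterates $Z_{k+1}=X\cup \mathrm{Win}_1(\mathsf{End}^\lambda(U,X,Z_k))$ until stabilization; Algorithm $\mathsf{WMPCoBuchi}$ starts with $X_0=\emptyset$ and iterates $X_{k+1}=X_k\cup\mathsf{ObjF}(X_k)$ until stabilization. $\mathrm{Win}_1(\mathsf{GDReach}(X))$ is computed once per call of $\mathsf{ObjF}$, by iterating $Y\mapsto Y\cup \mathsf{ICWEnd}(Y)$ from $X$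 until stabilization. $\mathsf{ICWEnd}(T)$ is the set of vertices from which player 1 can force that the window at $0$ is inductively closed in some $l\in\{1,\dots,\lambda\}$ with $\rho_l\in T$. It is computed as $\{v: C_\lambda(v)\ge0\}$, where $C_0=0$ on $T$, $C_0=-\infty$ off $T$, and $C_l(v)$ is the maximum ($v\in V_1$) or minimum ($v\in V_2$) over the edges $(v,v')$ of $w(v,v')\oplus\max\{C_0(v'),C_{l-1}(v')\}$; here $a\oplus b$ is $a+b$ if $a+b\ge0$ and $-\infty$ otherwise. $\mathrm{Win}_1(\mathsf{End}^\lambda(U,X,Z))$ is computed by $\mathsf{ICWEnd}$ on the game obtained from $G$ by adding a bit to the vertices that records whether $V\setminus U$ has been visited. Time counts elementary steps: an access to an array or list, a loop iteration or a Boolean operation costs $1$, and an arithmetic operation or comparison of integers costs the number of bits of its operands. There is an absolute constant $c$ such that for all such $G$, $U$, $\lambda$: 1. Algorithm $\mathsf{WMPCoBuchi}$, run on any listing of the vertices and edges of $G$, returns $\mathrm{Win}_1(\Omega)$ in time at most $c\cdot\lambda\,|V|^2(|V|+|E|)\cdot\max\{1,\lceil\log_2(\lambda W)\rceil\}$ (where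 $\lceil\log_2 0\rceil$ is read as $0$), and $\mathsf{ObjF}(X)$ returns $\mathrm{Win}_1(\mathsf F^\lambda(U,X))$ for every $X\subseteq V$. 2. $\mathrm{Win}_1(\Omega)$ is the least fixpoint of $X\mapsto \mathrm{Win}_1(\mathsf F^\lambda(U,X))$, and for every $X\subseteq V$, $\mathrm{Win}_1(\mathsf F^\lambda(U,X))$ is the greatest fixpoint of $Z\mapsto X\cup\mathrm{Win}_1(\mathsf{End}^\lambda(U,X,Z))$. 3. Player 1 has a finite-memory strategy, given by a Moore machine with at most $c\cdot\lambda^2\max\{1,W\}\,|V|^2$ states, that is winning for $\Omega$ from every vertex of $\mathrm{Win}_1(\Omega)$. 4. Player 2 has a finite-memory strategy, given by a Moore machine with at most $c\cdot\lambda^2\max\{1,W\}\,|V|$ states, that is winning for $\overline\Omega$ from every vertex of $\mathrm{Win}_2(\overline\Omega)$. -/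

import Mathlib

/-! ## Weighted two-player games -/

inductive Player where
  | one
  | two
  deriving DecidableEq

def Player.opponent : Player → Player
  | .one => .two
  | .two => .one

/-- A 1-weighted two-player game structure on the vertex set `V`; vertex `v` is controlled by
`owner v`.  The weight function is only meaningful, and only used, on edges. -/
structure Game (V : Type) where
  owner : V → Player
  edges : Finset (V × V)
  w : V → V → ℤ
  no_deadlock : ∀ v, ∃ v', (v, v') ∈ edges

namespace Game

variable {V : Type} (G : Game V)

/-- The maximum absolute value `W` of a weight of an edge. -/
def maxWeight : ℕ := G.edges.sup fun e => (G.w e.1 e.2).natAbs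

def Plays : Set (ℕ → V) := {ρ | ∀ k, (ρ k, ρ (k + 1)) ∈ G.edges}

/-- A strategy of player `p`: `toFun h v` is the vertex chosen after the history `h v`, the list `h`
being in chronological order. -/
structure Strategy (p : Player) where
  toFun : List V → V → V
  legal : ∀ h v, G.owner v = p → (v, toFun h v) ∈ G.edges

variable {G}

/-- The first `n` vertices and the `n`-th vertex of the play from `v₀` that is consistent with the
strategy `σ` of player `p` and the strategy `τ` of the opponent. -/
def outcomeAux {p : Player} (σ : G.Strategy p) (τ : G.Strategy p.opponent) (v₀ : V) :
    ℕ → List V × V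
  | 0 => ([], v₀)
  | n + 1 =>
    let h := (outcomeAux σ τ v₀ n).1
    let v := (outcomeAux σ τ v₀ n).2
    (h ++ [v], if G.owner v = p then σ.toFun h v else τ.toFun h v)

def outcome {p : Player} (σ : G.Strategy p) (τ : G.Strategy p.opponent) (v₀ : V) : ℕ → V :=
  fun n => (outcomeAux σ τ v₀ n).2

/-- The strategy `σ` of player `p` is winning from `v₀` for the objective `Obj` of player `p`. -/
def Strategy.WinsFrom {p : Player} (σ : G.Strategy p) (v₀ : V) (Obj : Set (ℕ → V)) : Prop :=
  ∀ τ : G.Strategy p.opponent, outcome σ τ v₀ ∈ Obj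

variable (G)

/-- The winning set of player `p` for the objective `Obj` of player `p`. -/
def winningSet (p : Player) (Obj : Set (ℕ → V)) : Set V :=
  {v | ∃ σ : G.Strategy p, σ.WinsFrom v Obj}

/-- A Moore machine encoding a finite-memory strategy of player `p`. -/
structure MooreMachine (p : Player) where
  Mem : Type
  [fintypeMem : Fintype Mem]
  init : Mem
  update : Mem → V → Mem
  next : Mem → V → V
  legal : ∀ m v, G.owner v = p → (v, next m v) ∈ G.edges

variable {G}

/-- The size of the memory. -/
def MooreMachine.size {p : Player} (A : G.MooreMachine p) : ℕ :=
  @Fintype.card A.Mem A.fintypeMem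

def MooreMachine.strategy {p : Player} (A : G.MooreMachine p) : G.Strategy p where
  toFun h v := A.next (h.foldl A.update A.init) v
  legal _ v hv := A.legal _ v hv

variable (G)

/-! ## Objectives -/

/-- The total payoff of the history `ρ k, …, ρ m`. -/
def TP (ρ : ℕ → V) (k m : ℕ) : ℤ := ∑ i ∈ Finset.Ico k m, G.w (ρ i) (ρ (i + 1))

/-- The mean payoff of the history `ρ k, …, ρ m`. -/
def MP (ρ : ℕ → V) (k m : ℕ) : ℚ := (G.TP ρ k m : ℚ) / ((m : ℚ) - (k : ℚ))

/-- The window mean-payoff objective `WMP(lam, ≥ 0)`. -/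
def WMP (lam : ℕ) : Set (ℕ → V) :=
  {ρ | ρ ∈ G.Plays ∧ ∀ k, ∃ l, 1 ≤ l ∧ l ≤ lam ∧ 0 ≤ G.MP ρ k (k + l)}

def Safe (U : Set V) : Set (ℕ → V) := {ρ | ρ ∈ G.Plays ∧ ∀ k, ρ k ∈ U}

/-- No vertex outside `U` is visited infinitely often. -/
def CoBuchi (U : Set V) : Set (ℕ → V) :=
  {ρ | ρ ∈ G.Plays ∧ ∀ v, v ∉ U → ¬ {k | ρ k = v}.Infinite}

/-- The `lam`-window at position `k` of `ρ` is closed in `m`. -/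
def Closed (lam : ℕ) (ρ : ℕ → V) (k m : ℕ) : Prop :=
  k < m ∧ m ≤ k + lam ∧ 0 ≤ G.TP ρ k m

/-- The `lam`-window at position `k` of `ρ` is inductively closed in `m`. -/
def InductivelyClosed (lam : ℕ) (ρ : ℕ → V) (k m : ℕ) : Prop :=
  G.Closed lam ρ k m ∧ ∀ k', k < k' → k' < m → G.Closed lam ρ k' m

/-- The history `ρ 0, …, ρ l` has a `lam`-good decomposition `d 0 < d 1 < ⋯ < d j`. -/
def HasGoodDecomposition (lam : ℕ) (ρ : ℕ → V) (l : ℕ) : Prop :=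
  ∃ (j : ℕ) (d : ℕ → ℕ), d 0 = 0 ∧ d j = l ∧
    ∀ i, i < j → G.InductivelyClosed lam ρ (d i) (d (i + 1))

/-- A vertex of `X` is reached at the end of a history that has a good decomposition. -/
def GDReach (lam : ℕ) (X : Set V) : Set (ℕ → V) :=
  {ρ | ρ ∈ G.Plays ∧ ∃ l, ρ l ∈ X ∧ G.HasGoodDecomposition lam ρ l}

def EndObj (lam : ℕ) (U X Z : Set V) : Set (ℕ → V) :=
  {ρ | ρ ∈ G.Plays ∧ ∃ l, 1 ≤ l ∧ l ≤ lam ∧ G.InductivelyClosed lam ρ 0 l ∧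
    (ρ l ∈ G.winningSet .one (G.GDReach lam X) ∨ (ρ l ∈ Z ∧ ∀ i, i ≤ l → ρ i ∈ U))}

def FObj (lam : ℕ) (U X : Set V) : Set (ℕ → V) :=
  (G.WMP lam ∩ G.Safe U) ∪ G.GDReach lam X

end Game

/-! ## Algorithms with a step count

A computation carries the number of elementary steps it makes.  Reading or writing one array cell,
starting one iteration of a loop, pushing an element on a list and a Boolean operation on two bits
cost one step each; creating an array costs its number of cells.  An arithmetic operation or a
comparison costs the number of bits of its operands.  An array indexed by `V` is a function on `V`,
and a set of vertices is an array of bits. -/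

structure Timed (α : Type) where
  val : α
  time : ℕ

namespace Timed

instance : Monad Timed where
  pure a := ⟨a, 0⟩
  bind x f := ⟨(f x.val).val, x.time + (f x.val).time⟩

/-- Make `k` steps. -/
def tick (k : ℕ) : Timed Unit := ⟨(), k⟩

def forEach {α β : Type} : List α → β → (β → α → Timed β) → Timed β
  | [], b, _ => ⟨b, 1⟩
  | a :: l, b, f => do
    tick 1
    let b' ← f b a
    forEach l b' f

/-- A new array whose cells are indexed by the elements of the list `l`, all of them set to `x`. -/
def newArray {ι α : Type} (l : List ι) (x : α) : Timed (ι → α) := ⟨fun _ => x, l.length + 1⟩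

def read {ι α : Type} (a : ι → α) (i : ι) : Timed α := ⟨a i, 1⟩

def write {ι α : Type} [DecidableEq ι] (a : ι → α) (i : ι) (x : α) : Timed (ι → α) :=
  ⟨Function.update a i x, 1⟩

def push {α : Type} (x : α) (l : List α) : Timed (List α) := ⟨x :: l, 1⟩

def or (a b : Bool) : Timed Bool := ⟨a || b, 1⟩

def and (a b : Bool) : Timed Bool := ⟨a && b, 1⟩

def not (a : Bool) : Timed Bool := ⟨!a, 1⟩

def beq (a b : Bool) : Timed Bool := ⟨a == b, 1⟩

/-- The number of bits of an element of `ℤ ∪ {-∞}` (with one bit for the sign).  Here and below,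
`none` stands for `-∞`. -/
def bits : Option ℤ → ℕ
  | none => 1
  | some z => z.natAbs.size + 1

/-- `a ⊕ b` is `a + b` if this is nonnegative, and `-∞` otherwise. -/
def oplus (a b : Option ℤ) : Timed (Option ℤ) :=
  ⟨match a, b with
    | some x, some y => if 0 ≤ x + y then some (x + y) else none
    | _, _ => none, bits a + bits b⟩

def max (a b : Option ℤ) : Timed (Option ℤ) :=
  ⟨match a, b with
    | some x, some y => if x ≤ y then some y else some x
    | some x, none => some x
    | none, y => y, bits a + bits b⟩

def min (a b : Option ℤ) : Timed (Option ℤ) :=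
  ⟨match a, b with
    | some x, some y => if x ≤ y then some x else some y
    | _, _ => none, bits a + bits b⟩

def isNonneg (a : Option ℤ) : Timed Bool :=
  ⟨match a with
    | some x => decide (0 ≤ x)
    | none => false, bits a⟩

end Timed

/-- The input of the algorithms: the list of the vertices, the array of their owners, and the array
of the lists of outgoing edges, each given by its target and its weight. -/
structure GameData (V : Type) where
  verts : List V
  owner : V → Player
  adj : V → List (V × ℤ)

/-- `D` is a listing, without repetition, of the vertices and edges of `G`. -/
structure GameData.Represents {V : Type} (D : GameData V) (G : Game V) : Prop where
  verts_nodup : D.verts.Nodup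
  mem_verts : ∀ v, v ∈ D.verts
  owner_eq : D.owner = G.owner
  adj_nodup : ∀ v, (D.adj v).Nodup
  mem_adj : ∀ v v' x, (v', x) ∈ D.adj v ↔ (v, v') ∈ G.edges ∧ x = G.w v v'

/-- Every game structure on a finite set has such a listing. -/
theorem GameData.exists_represents {V : Type} [Fintype V] (G : Game V) :
    ∃ D : GameData V, D.Represents G := by
  classical
  refine ⟨⟨Finset.univ.toList, G.owner, fun v =>
    ((Finset.univ.filter fun v' => (v, v') ∈ G.edges).toList.map fun v' => (v', G.w v v'))⟩,
    Finset.nodup_toList _, by simp, rfl, fun v => ?_, fun v v' x => ?_⟩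
  · exact (Finset.nodup_toList _).map fun a b h => (Prod.mk.inj h).1
  · simp only [List.mem_map, Finset.mem_toList, Finset.mem_filter, Finset.mem_univ, true_and,
      Prod.mk.injEq]
    constructor
    · rintro ⟨a, ha, rfl, rfl⟩
      exact ⟨ha, rfl⟩
    · rintro ⟨h, rfl⟩
      exact ⟨v', h, rfl, rfl⟩

namespace WMPAlgo

open Timed

variable {V : Type} [DecidableEq V]

/-- Maximum for player 1, minimum for player 2, of a collection of values and one more value;
the outer `none` stands for the optimum of the empty collection. -/
def improve : Player → Option (Option ℤ) → Option ℤ → Timed (Option (Option ℤ))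
  | _, none, x => do
    tick 1
    pure (some x)
  | .one, some y, x => do
    let z ← Timed.max y x
    pure (some z)
  | .two, some y, x => do
    let z ← Timed.min y x
    pure (some z)

/-- The optimum over the edges `(v, v')` of `w(v, v') ⊕ max {c₀(v'), c(v')}`. -/
def bestEdge (D : GameData V) (c₀ c : V → Option ℤ) (v : V) : Timed (Option ℤ) := do
  let es ← read D.adj v
  let p ← read D.owner v
  let best ← forEach es none fun acc e => do
    let a ← read c₀ e.1
    let b ← read c e.1
    let m ← Timed.max a b
    let x ← oplus (some e.2) m
    improve p acc x
  pure (best.getD none)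

/-- Algorithm `ICWEnd`: can player 1 inductively close the first window in `T`? -/
def icwEnd (D : GameData V) (lam : ℕ) (T : V → Bool) : Timed (V → Bool) := do
  let a ← newArray D.verts none
  let c₀ ← forEach D.verts a fun a v => do
    let t ← read T v
    if t then write a v (some 0) else write a v none
  let c ← forEach (List.range lam) c₀ fun c _ => do
    let a ← newArray D.verts none
    forEach D.verts a fun a v => do
      let x ← bestEdge D c₀ c v
      write a v x
  let r ← newArray D.verts false
  forEach D.verts r fun r v => do
    let x ← read c v
    let b ← isNonneg x
    write r v b

def union (D : GameData V) (A B : V → Bool) : Timed (V → Bool) := do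
  let r ← newArray D.verts false
  forEach D.verts r fun r v => do
    let a ← read A v
    let b ← read B v
    let c ← Timed.or a b
    write r v c

def sameSet (D : GameData V) (A B : V → Bool) : Timed Bool :=
  forEach D.verts true fun r v => do
    let a ← read A v
    let b ← read B v
    let c ← Timed.beq a b
    Timed.and r c

/-- `repeat A' ← A; A ← step A until A = A'`.  The numerical argument bounds the number of
iterations; the loops below are monotone and get the bound `|V| + 1`, within which they stop by
themselves. -/
def repeatUntilStable (D : GameData V) (step : (V → Bool) → Timed (V → Bool)) :
    ℕ → (V → Bool) → Timed (V → Bool)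
  | 0, A => pure A
  | n + 1, A => do
    let A' ← step A
    let b ← sameSet D A' A
    if b then pure A' else repeatUntilStable D step n A'

/-- Algorithm `GDEnd`: the winning set of player 1 for `GDReach lam X`. -/
def gdEnd (D : GameData V) (lam : ℕ) (X : V → Bool) : Timed (V → Bool) :=
  repeatUntilStable D (fun Y => do
    let T ← icwEnd D lam Y
    union D Y T) (D.verts.length + 1) X

/-- The game on `V × {0, 1}` in which the added bit tells whether the complement of `U` has been
visited. -/
def addBit (D : GameData V) (U : V → Bool) : Timed (GameData (V × Bool)) := do
  let vs ← forEach D.verts [] fun l v => do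
    let l' ← push (v, false) l
    push (v, true) l'
  let o ← newArray vs Player.one
  let owner' ← forEach vs o fun o x => do
    let p ← read D.owner x.1
    write o x p
  let a ← newArray vs []
  let adj' ← forEach vs a fun a x => do
    let es ← read D.adj x.1
    let es' ← forEach es [] fun l e => do
      let u ← read U e.1
      let n ← Timed.not u
      let b ← Timed.or x.2 n
      tick (bits (some e.2))
      push ((e.1, b), e.2) l
    write a x es'
  pure ⟨vs, owner', adj'⟩

/-- Algorithm `End`: the winning set of player 1 for `EndObj lam U X Z`, given the winning set `R`
of player 1 for `GDReach lam X`. -/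
def endAlg (D : GameData V) (lam : ℕ) (U R Z : V → Bool) : Timed (V → Bool) := do
  let D' ← addBit D U
  let t ← newArray D'.verts false
  let T ← forEach D'.verts t fun t x => do
    let r ← read R x.1
    let z ← read Z x.1
    let n ← Timed.not x.2
    let a ← Timed.and n z
    let b ← Timed.or r a
    write t x b
  let S ← icwEnd D' lam T
  let r ← newArray D.verts false
  forEach D.verts r fun r v => do
    let u ← read U v
    let n ← Timed.not u
    let s ← read S (v, n)
    write r v s

/-- Algorithm `ObjF`: a greatest fixpoint of `Z ↦ X ∪ End(U, X, Z)`. -/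
def objF (D : GameData V) (lam : ℕ) (U X : V → Bool) : Timed (V → Bool) := do
  let R ← gdEnd D lam X
  let Z₀ ← newArray D.verts true
  repeatUntilStable D (fun Z => do
    let T ← endAlg D lam U R Z
    union D X T) (D.verts.length + 1) Z₀

/-- Algorithm `WMPCoBuchi`: a least fixpoint of `X ↦ X ∪ ObjF(U, X)`. -/
def wmpCoBuchi (D : GameData V) (lam : ℕ) (U : V → Bool) : Timed (V → Bool) := do
  let X₀ ← newArray D.verts false
  repeatUntilStable D (fun X => do
    let Y ← objF D lam U X
    union D X Y) (D.verts.length + 1) X₀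

end WMPAlgo

/-!
The proof rests on one finite-horizon game. `Game.Force G T l v θ` says that from `v` player 1 can
end a window in `T` within `l` steps, inductively closed, and with total payoff at least the debt
`θ`; a step over an edge of weight `x` turns the debt `θ` into `max 0 (θ - x)`. The tables of the
algorithm `icwEnd` compute the largest debt that can be paid (`WMPAlgo.atLeast_table`). Iterating
this operator gives the sets `gdSet`, `endSet`, `fSet` and `winSet`: fixpoints over subsets of `V`,
reached after at most `|V|` rounds, which the algorithms compute round by round. It remains to see
that these sets are the winning sets, and this is done by exhibiting a strategy of player 1 inside
and a strategy of player 2 outside; in particular no determinacy theorem is needed.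

Player 1 plays one window after the other, each in the target that belongs to the vertex at which
the window starts (`Game.attacker`, `Game.AttackCut.exists_next`). Some edge is optimal for all
debts at once (`Game.exists_edge_advances`), so that she need not know the debt: it suffices to
remember the first vertex of the window, the number of steps left, and whether the window left `U`.

Player 2 plays against the greedy decomposition, in which each window ends at its first closing
(`Game.defender`, `Game.DefendCut.next`). This loses nothing: every good decomposition is refined by
the greedy one (`Game.InductivelyClosed.of_firstClosed`), and a play satisfies the window
mean-payoff objective if and only if the greedy decomposition goes on forever. He has to know the
debt in order to recognize the closing of the window, hence also the previous vertex. The index of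
the target he avoids need not be remembered, though: the targets decrease with the index, so that he
may always play against the first, largest, target that can still be avoided, and a good edge
against it is good against all later ones (`Game.exists_defend_edge`). This saves a factor `|V|` in
his memory.

For `FObj`, the windows of player 1 either descend to `X` or remain in `U` forever, and the windows
of player 2 either leave `U` or descend in the approximations `fIter`, which is possible only
finitely often. For `EndObj` player 2 does not start anew (`Game.defend_once`), as there any
inductive closure of the first window counts, not only the first closing. For the co-Büchi objective
the same arguments apply along the approximations `winIter`, the index of which player 1 can only
decrease, and at the fixpoint `winSet`.

The running time is a sum over nested loops. All numbers in the tables are at most `lam * W`, whence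
the factor `log (lam * W)` (`WMPAlgo.time_icwEnd_le`).
-/

/-! ### Plays, strategies and Moore machines -/

namespace Game

variable {V : Type} {G : Game V}

theorem outcome_mem_plays {p : Player} (σ : G.Strategy p) (τ : G.Strategy p.opponent) (v : V) :
    outcome σ τ v ∈ G.Plays := by
  intro k
  have h : outcome σ τ v (k + 1) = if G.owner (outcome σ τ v k) = p
      then σ.toFun (outcomeAux σ τ v k).1 (outcome σ τ v k)
      else τ.toFun (outcomeAux σ τ v k).1 (outcome σ τ v k) := rfl
  rw [h]
  split_ifs with hp
  · exact σ.legal _ _ hp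
  · refine τ.legal _ _ ?_
    revert hp
    cases G.owner (outcome σ τ v k) <;> cases p <;> simp [Player.opponent]

theorem outcome_comm (σ : G.Strategy .one) (τ : G.Strategy .two) (v : V) :
    outcome (p := .one) σ τ v = outcome (p := .two) τ σ v := by
  have h : ∀ n, outcomeAux (p := .one) σ τ v n = outcomeAux (p := .two) τ σ v n := by
    intro n
    induction n with
    | zero => rfl
    | succ n ih =>
      simp only [outcomeAux, ih]
      cases h : G.owner (outcomeAux (p := .two) τ σ v n).2 <;> simp
  funext n
  simp only [outcome, h n]

/-- The two players cannot both win, for complementary objectives. -/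
theorem notMem_winningSet_one {Obj : Set (ℕ → V)} {v : V} (τ : G.Strategy .two)
    (h : ∀ σ : G.Strategy .one, outcome (p := .two) τ σ v ∉ Obj) : v ∉ G.winningSet .one Obj := by
  rintro ⟨σ, hσ⟩
  exact h σ (outcome_comm σ τ v ▸ hσ τ)

/-- The memory of a Moore machine before the `n`-th vertex of a play is read. -/
def MooreMachine.memory {p : Player} (A : G.MooreMachine p) (ρ : ℕ → V) : ℕ → A.Mem
  | 0 => A.init
  | n + 1 => A.update (A.memory ρ n) (ρ n)

/-- A play that is consistent with a Moore machine. -/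
structure MooreMachine.Follows {p : Player} (A : G.MooreMachine p) (ρ : ℕ → V) : Prop where
  mem_plays : ρ ∈ G.Plays
  next_eq : ∀ n, G.owner (ρ n) = p → ρ (n + 1) = A.next (A.memory ρ n) (ρ n)

theorem MooreMachine.follows_outcome {p : Player} (A : G.MooreMachine p)
    (τ : G.Strategy p.opponent) (v : V) : A.Follows (outcome A.strategy τ v) := by
  have hm : ∀ n, (outcomeAux A.strategy τ v n).1.foldl A.update A.init =
      A.memory (outcome A.strategy τ v) n := by
    intro n
    induction n with
    | zero => rfl
    | succ n ih =>
      simp only [outcomeAux, List.foldl_append, List.foldl_cons, List.foldl_nil, ih,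
        MooreMachine.memory]
      rfl
  refine ⟨outcome_mem_plays _ _ _, fun n hn => ?_⟩
  have h : outcome A.strategy τ v (n + 1) = if G.owner (outcome A.strategy τ v n) = p
      then A.strategy.toFun (outcomeAux A.strategy τ v n).1 (outcome A.strategy τ v n)
      else τ.toFun (outcomeAux A.strategy τ v n).1 (outcome A.strategy τ v n) := rfl
  rw [h, if_pos hn, ← hm]
  rfl

theorem MooreMachine.winsFrom {p : Player} (A : G.MooreMachine p) {v : V} {Obj : Set (ℕ → V)}
    (h : ∀ ρ, A.Follows ρ → ρ 0 = v → ρ ∈ Obj) : A.strategy.WinsFrom v Obj :=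
  fun τ => h _ (A.follows_outcome τ v) rfl

/-! ### Windows and good decompositions -/

variable (G)

theorem TP_self (ρ : ℕ → V) (k : ℕ) : G.TP ρ k k = 0 := by simp [TP]

theorem TP_succ (ρ : ℕ → V) {k m : ℕ} (h : k ≤ m) :
    G.TP ρ k (m + 1) = G.TP ρ k m + G.w (ρ m) (ρ (m + 1)) :=
  Finset.sum_Ico_succ_top h _

theorem TP_add (ρ : ℕ → V) {k m n : ℕ} (h : k ≤ m) (h' : m ≤ n) :
    G.TP ρ k m + G.TP ρ m n = G.TP ρ k n :=
  Finset.sum_Ico_consecutive _ h h'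

theorem abs_weight_le {u v : V} (h : (u, v) ∈ G.edges) : (G.w u v).natAbs ≤ G.maxWeight :=
  Finset.le_sup (f := fun e : V × V => (G.w e.1 e.2).natAbs) h

theorem neg_TP_le {ρ : ℕ → V} (hρ : ρ ∈ G.Plays) (k n : ℕ) :
    -G.TP ρ k (k + n) ≤ n * G.maxWeight := by
  induction n with
  | zero => simp [TP_self]
  | succ n ih =>
    rw [← add_assoc, TP_succ G ρ (by omega)]
    have := G.abs_weight_le (hρ (k + n))
    push_cast
    have h : |G.w (ρ (k + n)) (ρ (k + n + 1))| ≤ (G.maxWeight : ℤ) := by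
      rw [Int.abs_eq_natAbs]; exact_mod_cast this
    have := abs_le.1 h
    linarith

theorem MP_nonneg_iff (ρ : ℕ → V) {k l : ℕ} (hl : 1 ≤ l) :
    0 ≤ G.MP ρ k (k + l) ↔ 0 ≤ G.TP ρ k (k + l) := by
  have h : (0 : ℚ) < ((k + l : ℕ) : ℚ) - k := by
    push_cast
    have : (1 : ℚ) ≤ l := by exact_mod_cast hl
    linarith
  rw [MP, le_div_iff₀ h, zero_mul]
  exact_mod_cast Iff.rfl

theorem mem_WMP_iff {lam : ℕ} {ρ : ℕ → V} :
    ρ ∈ G.WMP lam ↔ ρ ∈ G.Plays ∧ ∀ k, ∃ m, G.Closed lam ρ k m := by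
  refine and_congr_right fun _ => forall_congr' fun k => ?_
  constructor
  · rintro ⟨l, h1, h2, h3⟩
    exact ⟨k + l, by omega, by omega, (G.MP_nonneg_iff ρ h1).1 h3⟩
  · rintro ⟨m, h1, h2, h3⟩
    obtain ⟨l, rfl⟩ := Nat.exists_eq_add_of_lt h1
    exact ⟨l + 1, by omega, by omega, (G.MP_nonneg_iff ρ (by omega)).2 h3⟩

theorem inductivelyClosed_iff {lam : ℕ} {ρ : ℕ → V} {k m : ℕ} :
    G.InductivelyClosed lam ρ k m ↔
      k < m ∧ m ≤ k + lam ∧ ∀ k', k ≤ k' → k' < m → 0 ≤ G.TP ρ k' m := by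
  constructor
  · rintro ⟨⟨h1, h2, h3⟩, h⟩
    refine ⟨h1, h2, fun k' hk hm => ?_⟩
    rcases hk.eq_or_lt with rfl | hk
    · exact h3
    · exact (h k' hk hm).2.2
  · rintro ⟨h1, h2, h3⟩
    exact ⟨⟨h1, h2, h3 k le_rfl h1⟩, fun k' hk hm => ⟨hm, by omega, h3 k' hk.le hm⟩⟩

/-- The window at `k` is closed in `m`, and not before. -/
def FirstClosed (lam : ℕ) (ρ : ℕ → V) (k m : ℕ) : Prop :=
  G.Closed lam ρ k m ∧ ∀ m', k < m' → m' < m → G.TP ρ k m' < 0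

variable {G}

theorem Closed.exists_firstClosed {lam : ℕ} {ρ : ℕ → V} {k m : ℕ} (h : G.Closed lam ρ k m) :
    ∃ m', m' ≤ m ∧ G.FirstClosed lam ρ k m' := by
  classical
  have hex : ∃ m, G.Closed lam ρ k m := ⟨m, h⟩
  refine ⟨Nat.find hex, Nat.find_min' hex h, Nat.find_spec hex, fun m' h1 h2 => ?_⟩
  have h3 := Nat.find_min hex h2
  have h4 := (Nat.find_spec hex).2.1
  by_contra h5
  exact h3 ⟨h1, by omega, not_lt.1 h5⟩

/-- If a window is inductively closed in `m`, then closing windows greedily, each at the first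
possible position, leads to `m` too.  So the greedy decomposition of a history is good whenever
there is any good decomposition. -/
theorem InductivelyClosed.of_firstClosed {lam : ℕ} {ρ : ℕ → V} {P : ℕ → Prop}
    (hP : ∀ t m, P t → G.FirstClosed lam ρ t m → P m) {k m : ℕ}
    (h : G.InductivelyClosed lam ρ k m) (hk : P k) : P m := by
  induction hn : m - k using Nat.strong_induction_on generalizing k with
  | _ n ih =>
    obtain ⟨m', hm', hf⟩ := h.1.exists_firstClosed
    rcases hm'.eq_or_lt with rfl | hlt
    · exact hP _ _ hk hf
    · have hk' := hf.1.1
      refine ih (m - m') (by omega) (k := m') ?_ (hP _ _ hk hf) rfl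
      rw [inductivelyClosed_iff] at h ⊢
      exact ⟨hlt, by omega, fun k' h1 h2 => h.2.2 k' (by omega) h2⟩

theorem HasGoodDecomposition.of_firstClosed {lam : ℕ} {ρ : ℕ → V} {P : ℕ → Prop}
    (hP : ∀ t m, P t → G.FirstClosed lam ρ t m → P m) (h0 : P 0) {l : ℕ}
    (h : G.HasGoodDecomposition lam ρ l) : P l := by
  obtain ⟨j, d, hd0, hdj, hd⟩ := h
  have : ∀ i, i ≤ j → P (d i) := by
    intro i
    induction i with
    | zero => intro _; rwa [hd0]
    | succ i ih => intro hi; exact (hd i hi).of_firstClosed hP (ih (by omega))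
  exact hdj ▸ this j le_rfl

theorem hasGoodDecomposition_zero (lam : ℕ) (ρ : ℕ → V) : G.HasGoodDecomposition lam ρ 0 :=
  ⟨0, fun _ => 0, rfl, rfl, fun _ h => absurd h (Nat.not_lt_zero _)⟩

theorem HasGoodDecomposition.append {lam : ℕ} {ρ : ℕ → V} {l m : ℕ}
    (h : G.HasGoodDecomposition lam ρ l) (h' : G.InductivelyClosed lam ρ l m) :
    G.HasGoodDecomposition lam ρ m := by
  obtain ⟨j, d, hd0, hdj, hd⟩ := h
  refine ⟨j + 1, Function.update d (j + 1) m, ?_, by simp, fun i hi => ?_⟩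
  · rw [Function.update_of_ne (by omega), hd0]
  · rw [Function.update_of_ne (by omega)]
    rcases (Nat.lt_succ_iff.1 hi).eq_or_lt with rfl | hlt
    · rw [Function.update_self, hdj]; exact h'
    · rw [Function.update_of_ne (by omega)]; exact hd i hlt

/-- Consecutive inductively closed windows close all windows. -/
theorem forall_closed_of_cuts {lam : ℕ} {ρ : ℕ → V} {P S : ℕ → Prop} {t₀ : ℕ} (h₀ : P t₀)
    (h : ∀ t, t₀ ≤ t → P t →
      ∃ t', G.InductivelyClosed lam ρ t t' ∧ P t' ∧ ∀ i, t ≤ i → i ≤ t' → S i) :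
    ∀ k, t₀ ≤ k → (∃ m, G.Closed lam ρ k m) ∧ S k := by
  have key : ∀ n, ∃ t t', t₀ ≤ t ∧ t ≤ t₀ + n ∧ t₀ + n < t' ∧ G.InductivelyClosed lam ρ t t' ∧
      P t' ∧ ∀ i, t ≤ i → i ≤ t' → S i := by
    intro n
    induction n with
    | zero =>
      obtain ⟨t', h1, h2, h3⟩ := h t₀ le_rfl h₀
      exact ⟨t₀, t', le_rfl, le_rfl, h1.1.1, h1, h2, h3⟩
    | succ n ih =>
      obtain ⟨t, t', h0, h1, h2, h3, h4, h5⟩ := ih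
      by_cases hlt : t₀ + (n + 1) < t'
      · exact ⟨t, t', h0, by omega, hlt, h3, h4, h5⟩
      · obtain ⟨t'', g1, g2, g3⟩ := h t' (by omega) h4
        have := g1.1.1
        exact ⟨t', t'', by omega, by omega, by omega, g1, g2, g3⟩
  intro k hk
  obtain ⟨n, rfl⟩ := Nat.exists_eq_add_of_le hk
  obtain ⟨t, t', h0, h1, h2, h3, h4, h5⟩ := key n
  rw [inductivelyClosed_iff] at h3
  exact ⟨⟨t', h2, by omega, h3.2.2 _ h1 h2⟩, h5 _ h1 h2.le⟩

/-! ### Forcing the inductive closure of a window -/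

/-- Moving from `v` to `u` with the debt `θ`, player 1 either stops in `T` with the debt paid, or
continues from `u` with the remaining debt, where she wins if `F` holds. -/
def Advances (G : Game V) (T : Set V) (F : V → ℕ → Prop) (v : V) (θ : ℕ) (u : V) : Prop :=
  (u ∈ T ∧ (θ : ℤ) ≤ G.w v u) ∨ F u ((θ : ℤ) - G.w v u).toNat

/-- From `v`, player 1 can force a visit to `T` after at least one and at most `l` steps, at a
position `m` such that the total payoff up to `m` is at least `θ` from the initial position, and
nonnegative from all later ones. -/
def Force (G : Game V) (T : Set V) : ℕ → V → ℕ → Prop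
  | 0, _, _ => False
  | l + 1, v, θ =>
    match G.owner v with
    | .one => ∃ u, (v, u) ∈ G.edges ∧ G.Advances T (Force G T l) v θ u
    | .two => ∀ u, (v, u) ∈ G.edges → G.Advances T (Force G T l) v θ u

variable (G)

theorem force_succ_one {T : Set V} {l : ℕ} {v : V} {θ : ℕ} (h : G.owner v = .one) :
    G.Force T (l + 1) v θ ↔ ∃ u, (v, u) ∈ G.edges ∧ G.Advances T (G.Force T l) v θ u := by
  simp only [Force, h]

theorem force_succ_two {T : Set V} {l : ℕ} {v : V} {θ : ℕ} (h : G.owner v = .two) :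
    G.Force T (l + 1) v θ ↔ ∀ u, (v, u) ∈ G.edges → G.Advances T (G.Force T l) v θ u := by
  simp only [Force, h]

variable {G}

theorem Advances.mono {T T' : Set V} {F F' : V → ℕ → Prop} {v u : V} {θ θ' : ℕ} (hT : T ⊆ T')
    (hF : ∀ u θ θ', θ' ≤ θ → F u θ → F' u θ') (hθ : θ' ≤ θ) (h : G.Advances T F v θ u) :
    G.Advances T' F' v θ' u := by
  rcases h with ⟨h1, h2⟩ | h
  · exact Or.inl ⟨hT h1, by omega⟩
  · exact Or.inr (hF _ _ _ (by omega) h)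

theorem Force.mono {T T' : Set V} (hT : T ⊆ T') {l : ℕ} {v : V} {θ θ' : ℕ} (hθ : θ' ≤ θ)
    (h : G.Force T l v θ) : G.Force T' l v θ' := by
  induction l generalizing v θ θ' with
  | zero => exact h
  | succ l ih =>
    cases hv : G.owner v with
    | one =>
      rw [force_succ_one G hv] at h ⊢
      obtain ⟨u, hu, h⟩ := h
      exact ⟨u, hu, h.mono hT (fun _ _ _ h1 h2 => ih h1 h2) hθ⟩
    | two =>
      rw [force_succ_two G hv] at h ⊢
      exact fun u hu => (h u hu).mono hT (fun _ _ _ h1 h2 => ih h1 h2) hθ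

/-- Player 1 has an edge that is optimal for all debts simultaneously. -/
theorem exists_edge_advances (T : Set V) (l : ℕ) {v : V} (hv : G.owner v = .one) :
    ∃ u, (v, u) ∈ G.edges ∧
      ∀ θ, G.Force T (l + 1) v θ → G.Advances T (G.Force T l) v θ u := by
  classical
  by_contra hcon
  push Not at hcon
  choose! f hf hf' using hcon
  let s := G.edges.filter fun e => e.1 = v
  obtain ⟨v', hv'⟩ := G.no_deadlock v
  -- the largest of the debts with which some edge fails
  obtain ⟨e, he, hmax⟩ := s.exists_max_image (fun e => f e.2) ⟨(v, v'), by simp [s, hv']⟩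
  have he' : (v, e.2) ∈ G.edges := by
    obtain ⟨h1, h2⟩ := Finset.mem_filter.1 he
    rw [← h2]; exact h1
  obtain ⟨u, hu, h⟩ := (force_succ_one G hv).1 (hf _ he')
  refine hf' u hu (h.mono subset_rfl (fun _ _ _ h1 h2 => h2.mono subset_rfl h1) ?_)
  exact hmax (v, u) (by simp [s, hu])

end Game

/-! ### Iteration of monotone operators on sets of vertices -/

/-- A monotone sequence of subsets of a finite type with `n` elements that stops once it repeats
itself is constant from the index `n` on. -/
theorem Monotone.stable_of_card {V : Type} [Fintype V] {a : ℕ → Set V} (ha : Monotone a)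
    (hstat : ∀ k, a (k + 1) = a k → a (k + 2) = a (k + 1)) :
    a (Fintype.card V + 1) = a (Fintype.card V) := by
  by_contra hne
  have hlt : ∀ k, k ≤ Fintype.card V → a (k + 1) ≠ a k := by
    intro k hk
    induction hn : Fintype.card V - k generalizing k with
    | zero =>
      obtain rfl : k = Fintype.card V := by omega
      exact hne
    | succ n ih => exact fun h => ih (k + 1) (by omega) (by omega) (hstat k h)
  have hcard : ∀ k, k ≤ Fintype.card V + 1 → k ≤ (a k).ncard := by
    intro k
    induction k with
    | zero => intro _; exact Nat.zero_le _
    | succ k ih =>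
      intro hk
      have := Set.ncard_lt_ncard
        ((ha (Nat.le_add_right k 1)).ssubset_of_ne (hlt k (by omega)).symm) (Set.toFinite _)
      have := ih (by omega)
      omega
  have h1 := hcard _ le_rfl
  have h2 := Set.ncard_le_card (a (Fintype.card V + 1))
  rw [Nat.card_eq_fintype_card] at h2
  omega

section Iterate

variable {V : Type} {F : Set V → Set V}

theorem iterate_mono_of_subset (hF : Monotone F) {A : Set V} (hA : A ⊆ F A) :
    Monotone fun k => F^[k] A :=
  monotone_nat_of_le_succ fun k => by
    rw [Function.iterate_succ_apply]
    exact hF.iterate k hA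

theorem iterate_antitone_of_subset (hF : Monotone F) {A : Set V} (hA : F A ⊆ A) :
    Antitone fun k => F^[k] A :=
  antitone_nat_of_succ_le fun k => by
    rw [Function.iterate_succ_apply]
    exact hF.iterate k hA

theorem map_iterate_card_of_subset [Fintype V] (hF : Monotone F) {A : Set V} (hA : A ⊆ F A) :
    F (F^[Fintype.card V] A) = F^[Fintype.card V] A := by
  rw [← Function.iterate_succ_apply' F]
  refine (iterate_mono_of_subset hF hA).stable_of_card fun k h => ?_
  simp only [Function.iterate_succ_apply'] at h ⊢
  simp only [h]

theorem map_iterate_card_of_superset [Fintype V] (hF : Monotone F) {A : Set V} (hA : F A ⊆ A) :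
    F (F^[Fintype.card V] A) = F^[Fintype.card V] A := by
  rw [← Function.iterate_succ_apply' F]
  have hanti := iterate_antitone_of_subset hF hA
  refine compl_injective (Monotone.stable_of_card (a := fun k => (F^[k] A)ᶜ)
    (fun i j hij => Set.compl_subset_compl.2 (hanti hij)) fun k h => ?_)
  have h := compl_injective h
  simp only [Function.iterate_succ_apply'] at h ⊢
  simp only [h]

end Iterate

namespace Game

/-! ### The winning sets as iterated fixpoints -/

/-- The game on `V × Bool` in which the added bit tells whether a vertex off `U` has been visited.
-/
def addBit {V : Type} [DecidableEq V] (G : Game V) (U : V → Bool) : Game (V × Bool) where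
  owner x := G.owner x.1
  edges := (G.edges ×ˢ (Finset.univ : Finset Bool)).image
    fun e => ((e.1.1, e.2), (e.1.2, e.2 || !U e.1.2))
  w x y := G.w x.1 y.1
  no_deadlock x := by
    obtain ⟨v', h⟩ := G.no_deadlock x.1
    exact ⟨(v', x.2 || !U v'), Finset.mem_image.2 ⟨((x.1, v'), x.2), by simp [h], rfl⟩⟩

variable {V : Type} [DecidableEq V] (G : Game V) (lam : ℕ) (U : V → Bool)

@[simp]
theorem mem_addBit_edges {x y : V × Bool} :
    (x, y) ∈ (G.addBit U).edges ↔ (x.1, y.1) ∈ G.edges ∧ y.2 = (x.2 || !U y.1) := by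
  obtain ⟨v, b⟩ := x
  obtain ⟨u, c⟩ := y
  simp only [addBit, Finset.mem_image, Finset.mem_product, Finset.mem_univ, and_true,
    Prod.mk.injEq, Prod.exists]
  constructor
  · rintro ⟨v, u, b, h, ⟨rfl, rfl⟩, rfl, rfl⟩
    exact ⟨h, rfl⟩
  · rintro ⟨h, rfl⟩
    exact ⟨v, u, b, h, ⟨rfl, rfl⟩, rfl, rfl⟩

theorem card_addBit_edges_le : (G.addBit U).edges.card ≤ 2 * G.edges.card := by
  refine Finset.card_image_le.trans ?_
  rw [Finset.card_product, Finset.card_univ, Fintype.card_bool, mul_comm]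

theorem addBit_maxWeight_le : (G.addBit U).maxWeight ≤ G.maxWeight :=
  Finset.sup_le fun _ he => G.abs_weight_le ((G.mem_addBit_edges U).1 he).1

theorem force_addBit_fst (T : Set V) {l : ℕ} {x : V × Bool} {θ : ℕ} :
    (G.addBit U).Force {y | y.1 ∈ T} l x θ ↔ G.Force T l x.1 θ := by
  induction l generalizing x θ with
  | zero => exact Iff.rfl
  | succ l ih =>
    have hadv : ∀ y, (G.addBit U).Advances {y | y.1 ∈ T} ((G.addBit U).Force {y | y.1 ∈ T} l) x θ y
        ↔ G.Advances T (G.Force T l) x.1 θ y.1 := fun y => or_congr Iff.rfl ih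
    cases h : G.owner x.1 with
    | one =>
      rw [force_succ_one _ (show (G.addBit U).owner x = .one from h), force_succ_one _ h]
      constructor
      · rintro ⟨y, hy, h⟩
        exact ⟨y.1, ((G.mem_addBit_edges U).1 hy).1, (hadv y).1 h⟩
      · rintro ⟨u, hu, h⟩
        exact ⟨(u, x.2 || !U u), (G.mem_addBit_edges U).2 ⟨hu, rfl⟩, (hadv _).2 h⟩
    | two =>
      rw [force_succ_two _ (show (G.addBit U).owner x = .two from h), force_succ_two _ h]
      constructor
      · intro h u hu
        exact (hadv (u, x.2 || !U u)).1 (h _ ((G.mem_addBit_edges U).2 ⟨hu, rfl⟩))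
      · intro h y hy
        exact (hadv y).2 (h y.1 ((G.mem_addBit_edges U).1 hy).1)

/-- The vertices from which player 1 can inductively close the first window in `T`. -/
def icw {V : Type} (G : Game V) (lam : ℕ) (T : Set V) : Set V := {v | G.Force T lam v 0}

theorem icw_mono {V : Type} (G : Game V) (lam : ℕ) : Monotone (G.icw lam) :=
  fun _ _ h _ hv => Force.mono h le_rfl hv

/-- The vertices from which player 1 can reach `X` by at most `j` inductively closed windows. -/
def gdIter {V : Type} (G : Game V) (lam : ℕ) (X : Set V) (j : ℕ) : Set V :=
  (fun Y => Y ∪ G.icw lam Y)^[j] X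

/-- The limit of the increasing sequence `gdIter`; it is the winning set for `GDReach lam X`. -/
def gdSet {V : Type} [Fintype V] (G : Game V) (lam : ℕ) (X : Set V) : Set V :=
  G.gdIter lam X (Fintype.card V)

/-- The set where a window has to end for `EndObj`, when `R` is the winning set for `GDReach`. -/
def endTarget {V : Type} (R Z : Set V) : Set (V × Bool) :=
  {x | x.1 ∈ R ∨ (x.1 ∈ Z ∧ x.2 = false)}

/-- The winning set for `EndObj`, when `R` is the winning set for `GDReach`. -/
def endSet (R Z : Set V) : Set V :=
  {v | (G.addBit U).Force (endTarget R Z) lam (v, !U v) 0}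

theorem gdIter_succ {V : Type} (G : Game V) (lam : ℕ) (X : Set V) (j : ℕ) :
    G.gdIter lam X (j + 1) = G.gdIter lam X j ∪ G.icw lam (G.gdIter lam X j) :=
  Function.iterate_succ_apply' _ _ _

theorem union_icw_mono {V : Type} (G : Game V) (lam : ℕ) :
    Monotone fun Y : Set V => Y ∪ G.icw lam Y :=
  fun _ _ h => Set.union_subset_union h (G.icw_mono lam h)

theorem gdIter_mono {V : Type} (G : Game V) (lam : ℕ) (X : Set V) : Monotone (G.gdIter lam X) :=
  iterate_mono_of_subset (G.union_icw_mono lam) Set.subset_union_left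

theorem gdSet_mono {V : Type} [Fintype V] (G : Game V) (lam : ℕ) : Monotone (G.gdSet lam) :=
  (G.union_icw_mono lam).iterate _

theorem subset_gdSet {V : Type} [Fintype V] (G : Game V) (lam : ℕ) (X : Set V) :
    X ⊆ G.gdSet lam X :=
  G.gdIter_mono lam X (Nat.zero_le _)

theorem union_icw_gdSet {V : Type} [Fintype V] (G : Game V) (lam : ℕ) (X : Set V) :
    G.gdSet lam X ∪ G.icw lam (G.gdSet lam X) = G.gdSet lam X :=
  map_iterate_card_of_subset (G.union_icw_mono lam) Set.subset_union_left

theorem endTarget_mono {V : Type} {R R' Z Z' : Set V} (hR : R ⊆ R') (hZ : Z ⊆ Z') :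
    endTarget R Z ⊆ endTarget R' Z' := by
  rintro x (h | ⟨h, h'⟩)
  exacts [Or.inl (hR h), Or.inr ⟨hZ h, h'⟩]

theorem endSet_mono {R R' Z Z' : Set V} (hR : R ⊆ R') (hZ : Z ⊆ Z') :
    G.endSet lam U R Z ⊆ G.endSet lam U R' Z' :=
  fun _ hv => Force.mono (endTarget_mono hR hZ) le_rfl hv

theorem union_endSet_mono (X R : Set V) : Monotone fun Z : Set V => X ∪ G.endSet lam U R Z :=
  fun _ _ h => Set.union_subset_union subset_rfl (G.endSet_mono lam U subset_rfl h)

theorem icw_subset_endSet (R Z : Set V) : G.icw lam R ⊆ G.endSet lam U R Z := by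
  intro v hv
  refine Force.mono (T := {y : V × Bool | y.1 ∈ R}) (fun y hy => Or.inl hy) le_rfl ?_
  rwa [force_addBit_fst]

variable [Fintype V]

/-- The approximations from above of the winning set for `FObj lam U X`. -/
def fIter (X : Set V) (k : ℕ) : Set V :=
  (fun Z => X ∪ G.endSet lam U (G.gdSet lam X) Z)^[k] Set.univ

/-- The limit of the decreasing sequence `fIter`; it is the winning set for `FObj lam U X`. -/
def fSet (X : Set V) : Set V := G.fIter lam U X (Fintype.card V)

theorem fIter_succ (X : Set V) (k : ℕ) :
    G.fIter lam U X (k + 1) = X ∪ G.endSet lam U (G.gdSet lam X) (G.fIter lam U X k) :=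
  Function.iterate_succ_apply' _ _ _

theorem fIter_antitone (X : Set V) : Antitone (G.fIter lam U X) :=
  iterate_antitone_of_subset (G.union_endSet_mono lam U X _) (Set.subset_univ _)

theorem union_endSet_fSet (X : Set V) :
    X ∪ G.endSet lam U (G.gdSet lam X) (G.fSet lam U X) = G.fSet lam U X :=
  map_iterate_card_of_superset (G.union_endSet_mono lam U X _) (Set.subset_univ _)

theorem subset_fIter {X Z : Set V} (h : Z ⊆ X ∪ G.endSet lam U (G.gdSet lam X) Z) (k : ℕ) :
    Z ⊆ G.fIter lam U X k := by
  induction k with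
  | zero => exact Set.subset_univ _
  | succ k ih =>
    rw [fIter_succ]
    exact h.trans (G.union_endSet_mono lam U X _ ih)

theorem subset_fSet (X : Set V) : X ⊆ G.fSet lam U X := by
  rw [← union_endSet_fSet]
  exact Set.subset_union_left

theorem gdSet_subset_fSet (X : Set V) : G.gdSet lam X ⊆ G.fSet lam U X := by
  suffices h : ∀ j, G.gdIter lam X j ⊆ G.fSet lam U X from h _
  intro j
  induction j with
  | zero => exact G.subset_fSet lam U X
  | succ j ih =>
    rw [gdIter_succ]
    refine Set.union_subset ih fun v hv => ?_
    rw [← union_endSet_fSet]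
    refine Or.inr (G.icw_subset_endSet lam U _ _ ?_)
    have h := (G.union_icw_gdSet lam X).subset
    have hj : G.gdIter lam X j ⊆ G.gdSet lam X := by
      rcases le_total j (Fintype.card V) with hle | hle
      · exact G.gdIter_mono lam X hle
      · obtain ⟨i, rfl⟩ := Nat.exists_eq_add_of_le' hle
        rw [gdIter, Function.iterate_add_apply]
        exact (Function.iterate_fixed (G.union_icw_gdSet lam X) i).subset
    exact G.icw_mono lam hj hv

theorem fSet_mono : Monotone (G.fSet lam U) := by
  intro X X' h
  refine G.subset_fIter lam U ?_ _
  conv_lhs => rw [← union_endSet_fSet]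
  exact Set.union_subset_union h (G.endSet_mono lam U (G.gdSet_mono lam h) subset_rfl)

/-- The approximations from below of the winning set of the window mean-payoff objective with the
co-Büchi condition. -/
def winIter (i : ℕ) : Set V := (fun X => X ∪ G.fSet lam U X)^[i] ∅

/-- The limit of the increasing sequence `winIter`. -/
def winSet : Set V := G.winIter lam U (Fintype.card V)

theorem winIter_succ (i : ℕ) :
    G.winIter lam U (i + 1) = G.winIter lam U i ∪ G.fSet lam U (G.winIter lam U i) :=
  Function.iterate_succ_apply' _ _ _

theorem union_fSet_mono : Monotone fun X : Set V => X ∪ G.fSet lam U X :=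
  fun _ _ h => Set.union_subset_union h (G.fSet_mono lam U h)

theorem winIter_mono : Monotone (G.winIter lam U) :=
  iterate_mono_of_subset (G.union_fSet_mono lam U) Set.subset_union_left

theorem union_fSet_winSet :
    G.winSet lam U ∪ G.fSet lam U (G.winSet lam U) = G.winSet lam U :=
  map_iterate_card_of_subset (G.union_fSet_mono lam U) Set.subset_union_left

theorem fSet_winSet : G.fSet lam U (G.winSet lam U) = G.winSet lam U :=
  Set.Subset.antisymm ((Set.subset_union_right).trans (G.union_fSet_winSet lam U).subset)
    (G.subset_fSet lam U _)

theorem gdSet_winSet : G.gdSet lam (G.winSet lam U) = G.winSet lam U :=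
  Set.Subset.antisymm ((G.gdSet_subset_fSet lam U _).trans (G.fSet_winSet lam U).subset)
    (G.subset_gdSet lam _)

theorem winSet_subset {X : Set V} (h : G.fSet lam U X ⊆ X) : G.winSet lam U ⊆ X := by
  suffices ∀ i, G.winIter lam U i ⊆ X from this _
  intro i
  induction i with
  | zero => exact Set.empty_subset _
  | succ i ih =>
    rw [winIter_succ]
    exact Set.union_subset ih ((G.fSet_mono lam U ih).trans h)

end Game

/-! ### Finite-memory strategies -/

namespace Game

variable {V : Type} [DecidableEq V] (G : Game V) (lam : ℕ) (U : V → Bool)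

open Classical in
/-- The target, the number of steps left and the bit of player 1 at the vertex `v`, when the memory
is `m`.  The target is given by the vertex where the current window was opened; a new window is
opened at `v` once the old one cannot be continued.  If the target could be forced from the first
vertex on, this happens only where the old window has just been closed in the target. -/
noncomputable def attackState (T : V → Set (V × Bool)) (m : V × ℕ × Bool) (v : V) : V × ℕ × Bool :=
  if (G.addBit U).Force (T m.1) m.2.1 (v, m.2.2 || !U v) 0
  then (m.1, m.2.1, m.2.2 || !U v) else (v, lam, !U v)

theorem exists_attack_edge (T : Set (V × Bool)) (l : ℕ) (v : V) (b : Bool) :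
    ∃ u, (v, u) ∈ G.edges ∧ (G.owner v = .one → ∀ θ, (G.addBit U).Force T l (v, b) θ →
      (G.addBit U).Advances T ((G.addBit U).Force T (l - 1)) (v, b) θ (u, b || !U u)) := by
  cases hv : G.owner v with
  | two =>
    obtain ⟨u, hu⟩ := G.no_deadlock v
    exact ⟨u, hu, by simp⟩
  | one =>
    cases l with
    | zero =>
      obtain ⟨u, hu⟩ := G.no_deadlock v
      exact ⟨u, hu, fun _ _ h => h.elim⟩
    | succ l =>
      obtain ⟨⟨u, c⟩, hu, h⟩ := exists_edge_advances (G := G.addBit U) T l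
        (v := (v, b)) hv
      rw [mem_addBit_edges] at hu
      obtain ⟨hu, rfl⟩ : _ ∧ c = (b || !U u) := hu
      exact ⟨u, hu, fun _ => h⟩

/-- The Moore machine of player 1 that closes windows one after the other, a window opened at `v`
in the target `T v` whenever this can be forced.  The debt need not be remembered, by
`exists_edge_advances`. -/
noncomputable def attacker [Fintype V] [Nonempty V] (T : V → Set (V × Bool)) :
    G.MooreMachine .one where
  Mem := V × Fin (lam + 1) × Bool
  init := (Classical.arbitrary V, 0, false)
  update m v :=
    let s := G.attackState lam U T (m.1, m.2.1, m.2.2) v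
    (s.1, Fin.ofNat (lam + 1) (s.2.1 - 1), s.2.2)
  next m v :=
    let s := G.attackState lam U T (m.1, m.2.1, m.2.2) v
    (G.exists_attack_edge U (T s.1) s.2.1 v s.2.2).choose
  legal m v _ :=
    let s := G.attackState lam U T (m.1, m.2.1, m.2.2) v
    (G.exists_attack_edge U (T s.1) s.2.1 v s.2.2).choose_spec.1

variable {G lam U}

theorem attacker_size [Fintype V] [Nonempty V] (T : V → Set (V × Bool)) :
    (G.attacker lam U T).size = Fintype.card V * ((lam + 1) * 2) := by
  have h : (G.attacker lam U T).size = Fintype.card (V × Fin (lam + 1) × Bool) := rfl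
  rw [h]
  simp

theorem attackState_le {m : V × ℕ × Bool} (hm : m.2.1 ≤ lam) (v : V) :
    (G.attackState lam U T m v).2.1 ≤ lam := by
  unfold attackState
  split_ifs
  exacts [hm, le_rfl]

section Attacker

variable [Fintype V] [Nonempty V] {T : V → Set (V × Bool)} {ρ : ℕ → V}

variable (G lam U T ρ) in
/-- The state of player 1 at the `n`-th vertex of a play. -/
noncomputable def attackStateAt (n : ℕ) : V × ℕ × Bool :=
  let m : V × Fin (lam + 1) × Bool := (G.attacker lam U T).memory ρ n
  G.attackState lam U T (m.1, m.2.1, m.2.2) (ρ n)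

theorem attackStateAt_zero : G.attackStateAt lam U T ρ 0 = (ρ 0, lam, !U (ρ 0)) :=
  if_neg fun h => h

theorem attackStateAt_succ (n : ℕ) : G.attackStateAt lam U T ρ (n + 1) =
    G.attackState lam U T ((G.attackStateAt lam U T ρ n).1, (G.attackStateAt lam U T ρ n).2.1 - 1,
      (G.attackStateAt lam U T ρ n).2.2) (ρ (n + 1)) := by
  set s := G.attackStateAt lam U T ρ n with hs
  have h : G.attackStateAt lam U T ρ (n + 1) = G.attackState lam U T
      (s.1, (Fin.ofNat (lam + 1) (s.2.1 - 1)).val, s.2.2) (ρ (n + 1)) := rfl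
  have hle : s.2.1 ≤ lam := attackState_le (Nat.lt_succ_iff.1 (Fin.is_lt _)) _
  rw [h, Fin.val_ofNat, Nat.mod_eq_of_lt (by omega)]

/-- The guarantee of player 1 within a window: the window will be closed inductively in the target,
and a new window will be opened at that moment. -/
theorem exists_cut_of_force (hρ : (G.attacker lam U T).Follows ρ) {q : V} (l n : ℕ) {b : Bool}
    {θ : ℕ} (hs : G.attackStateAt lam U T ρ n = (q, l, b))
    (h : (G.addBit U).Force (T q) l (ρ n, b) θ) :
    ∃ m, n < m ∧ m ≤ n + l ∧ (∀ k, n ≤ k → k < m → 0 ≤ G.TP ρ k m) ∧ θ ≤ G.TP ρ n m ∧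
      (∃ c, (ρ m, c) ∈ T q ∧ (c = false → b = false ∧ ∀ i, n < i → i ≤ m → U (ρ i) = true)) ∧
      G.attackStateAt lam U T ρ m = (ρ m, lam, !U (ρ m)) := by
  induction l generalizing n b θ with
  | zero => exact h.elim
  | succ l ih =>
    set c := b || !U (ρ (n + 1)) with hc
    have hadv : (G.addBit U).Advances (T q) ((G.addBit U).Force (T q) l) (ρ n, b) θ
        (ρ (n + 1), c) := by
      cases hv : G.owner (ρ n) with
      | one =>
        have hnext : ρ (n + 1) = (G.exists_attack_edge U
          (T (G.attackStateAt lam U T ρ n).1) (G.attackStateAt lam U T ρ n).2.1 (ρ n)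
          (G.attackStateAt lam U T ρ n).2.2).choose := hρ.next_eq n hv
        rw [hs] at hnext
        have := (G.exists_attack_edge U (T q) (l + 1) (ρ n) b).choose_spec.2 hv θ h
        rwa [← hnext] at this
      | two =>
        rw [force_succ_two _ (show (G.addBit U).owner (ρ n, b) = .two from hv)] at h
        exact h _ ((G.mem_addBit_edges U).2 ⟨hρ.mem_plays n, rfl⟩)
    have hs' : G.attackStateAt lam U T ρ (n + 1) =
        G.attackState lam U T (q, l, b) (ρ (n + 1)) := by
      rw [attackStateAt_succ, hs]; rfl
    have hcU : c = false → b = false ∧ U (ρ (n + 1)) = true := by simp [hc]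
    have hone : G.TP ρ n (n + 1) = G.w (ρ n) (ρ (n + 1)) := by
      rw [TP_succ G ρ le_rfl, TP_self, zero_add]
    by_cases hF : (G.addBit U).Force (T q) l (ρ (n + 1), c) 0
    · -- the window goes on, whether or not it could have been ended here
      obtain ⟨θ', hF', hθ'⟩ : ∃ θ' : ℕ, (G.addBit U).Force (T q) l (ρ (n + 1), c) θ' ∧
          (θ : ℤ) ≤ G.w (ρ n) (ρ (n + 1)) + θ' := by
        rcases hadv with ⟨-, h2⟩ | h2
        · have h2 : (θ : ℤ) ≤ G.w (ρ n) (ρ (n + 1)) := h2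
          exact ⟨0, hF, by simpa using h2⟩
        · refine ⟨_, h2, ?_⟩
          change (θ : ℤ) ≤ G.w (ρ n) (ρ (n + 1)) + ((θ - G.w (ρ n) (ρ (n + 1))).toNat : ℤ)
          omega
      obtain ⟨m, h1, h2, h3, h4, ⟨d, h5, h6⟩, h7⟩ := ih (n + 1) (b := c)
        (hs'.trans (if_pos hF)) hF'
      have hsum : G.TP ρ n m = G.w (ρ n) (ρ (n + 1)) + G.TP ρ (n + 1) m := by
        rw [← hone, TP_add G ρ (by omega) (by omega)]
      refine ⟨m, by omega, by omega, fun k hk hkm => ?_, by omega, ⟨d, h5, fun hd => ?_⟩, h7⟩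
      · rcases hk.eq_or_lt with rfl | hk
        · omega
        · exact h3 k hk hkm
      · obtain ⟨g1, g2⟩ := h6 hd
        obtain ⟨g3, g4⟩ := hcU g1
        refine ⟨g3, fun i hi him => ?_⟩
        rcases (Nat.succ_le_of_lt hi).eq_or_lt with rfl | hi
        · exact g4
        · exact g2 i hi him
    · rcases hadv with ⟨h1, h2⟩ | h2
      · have h2 : (θ : ℤ) ≤ G.w (ρ n) (ρ (n + 1)) := h2
        refine ⟨n + 1, by omega, by omega, fun k hk hkm => ?_, by omega, ⟨c, h1, fun hd => ?_⟩,
          hs'.trans (if_neg hF)⟩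
        · obtain rfl : k = n := by omega
          omega
        · obtain ⟨g3, g4⟩ := hcU hd
          refine ⟨g3, fun i hi him => ?_⟩
          obtain rfl : i = n + 1 := by omega
          exact g4
      · exact (hF (h2.mono subset_rfl (Nat.zero_le _))).elim

variable (G lam U T ρ) in
/-- Player 1 opens a new window at the position `t`. -/
def AttackCut (t : ℕ) : Prop := G.attackStateAt lam U T ρ t = (ρ t, lam, !U (ρ t))

theorem attackCut_zero : G.AttackCut lam U T ρ 0 := attackStateAt_zero

theorem AttackCut.exists_next (hρ : (G.attacker lam U T).Follows ρ) {t : ℕ}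
    (ht : G.AttackCut lam U T ρ t) (h : (G.addBit U).Force (T (ρ t)) lam (ρ t, !U (ρ t)) 0) :
    ∃ m, G.InductivelyClosed lam ρ t m ∧ G.AttackCut lam U T ρ m ∧
      ∃ c, (ρ m, c) ∈ T (ρ t) ∧ (c = false → ∀ i, t ≤ i → i ≤ m → U (ρ i) = true) := by
  obtain ⟨m, h1, h2, h3, -, ⟨c, h5, h6⟩, h7⟩ := exists_cut_of_force hρ lam t ht h
  refine ⟨m, (G.inductivelyClosed_iff).2 ⟨h1, h2, h3⟩, h7, c, h5, fun hc i hi him => ?_⟩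
  rcases hi.eq_or_lt with rfl | hi
  · simpa using (h6 hc).1
  · exact (h6 hc).2 i hi him

end Attacker

/-! ### The strategies of player 2 -/

variable (G lam U)

/-- The number of steps left, the debt and the bit of player 2 at the vertex `v`, when the memory is
`m`, which holds the previous vertex and the values there.  If `r` is set then player 2
starts anew at the first position where the window is closed. -/
def defendState (r : Bool) (m : Option (V × ℕ × ℕ × Bool)) (v : V) : ℕ × ℕ × Bool :=
  match m with
  | none => (lam, 0, !U v)
  | some (u, l, θ, b) =>
    if r = true ∧ (θ : ℤ) ≤ G.w u v then (lam, 0, !U v)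
    else (l - 1, ((θ : ℤ) - G.w u v).toNat, b || !U v)

/-- For a decreasing family of targets, player 2 has an edge that prevents player 1 from reaching
any of the targets that can be avoided: the best edge against the first of them. -/
theorem exists_defend_edge {ι : Type} [LinearOrder ι] [WellFoundedLT ι]
    {T : ι → Set (V × Bool)} (hT : Antitone T) (l : ℕ) (v : V) (θ : ℕ) (b : Bool) :
    ∃ u, (v, u) ∈ G.edges ∧ (G.owner v = .two → ∀ k, ¬(G.addBit U).Force (T k) (l + 1) (v, b) θ →
      ¬(G.addBit U).Advances (T k) ((G.addBit U).Force (T k) l) (v, b) θ (u, b || !U u)) := by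
  by_cases h : ∃ k, ¬(G.addBit U).Force (T k) (l + 1) (v, b) θ
  · obtain ⟨k, hk, hmin⟩ := WellFounded.has_min (wellFounded_lt (α := ι))
      {k | ¬(G.addBit U).Force (T k) (l + 1) (v, b) θ} h
    cases hv : G.owner v with
    | one =>
      obtain ⟨u, hu⟩ := G.no_deadlock v
      exact ⟨u, hu, by simp⟩
    | two =>
      have hk : ¬(G.addBit U).Force (T k) (l + 1) (v, b) θ := hk
      rw [force_succ_two _ (show (G.addBit U).owner (v, b) = .two from hv)] at hk
      push Not at hk
      obtain ⟨⟨u, c⟩, hu, hk⟩ := hk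
      obtain ⟨hu, rfl⟩ : _ ∧ c = (b || !U u) := (G.mem_addBit_edges U).1 hu
      refine ⟨u, hu, fun _ k' hk' hadv => hk ?_⟩
      exact hadv.mono (hT (not_lt.1 (hmin k' hk')))
        (fun _ _ _ h1 h2 => h2.mono (hT (not_lt.1 (hmin k' hk'))) h1) le_rfl
  · push Not at h
    obtain ⟨u, hu⟩ := G.no_deadlock v
    exact ⟨u, hu, fun _ k hk => (hk (h k)).elim⟩

/-- The Moore machine of player 2 against a decreasing family of targets.  The index of the target
need not be remembered, by `exists_defend_edge`.  The debt is at most `lam * maxWeight` as long as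
the window is open. -/
noncomputable def defender [Fintype V] {ι : Type} [LinearOrder ι] [WellFoundedLT ι]
    {T : ι → Set (V × Bool)} (hT : Antitone T) (r : Bool) : G.MooreMachine .two where
  Mem := Option (V × Fin (lam + 1) × Fin (lam * G.maxWeight + 1) × Bool)
  init := none
  update m v :=
    let s := G.defendState lam U r (m.map fun x => (x.1, x.2.1, x.2.2.1, x.2.2.2)) v
    some (v, Fin.ofNat _ s.1, Fin.ofNat _ s.2.1, s.2.2)
  next m v :=
    let s := G.defendState lam U r (m.map fun x => (x.1, x.2.1, x.2.2.1, x.2.2.2)) v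
    (G.exists_defend_edge U hT (s.1 - 1) v s.2.1 s.2.2).choose
  legal m v _ :=
    let s := G.defendState lam U r (m.map fun x => (x.1, x.2.1, x.2.2.1, x.2.2.2)) v
    (G.exists_defend_edge U hT (s.1 - 1) v s.2.1 s.2.2).choose_spec.1

variable {G lam U}

section Defender

variable [Fintype V] {ι : Type} [LinearOrder ι] [WellFoundedLT ι]
  {T : ι → Set (V × Bool)} {hT : Antitone T} {r : Bool} {ρ : ℕ → V}

theorem defender_size : (G.defender lam U hT r).size =
    Fintype.card V * ((lam + 1) * ((lam * G.maxWeight + 1) * 2)) + 1 := by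
  have h : (G.defender lam U hT r).size =
      Fintype.card (Option (V × Fin (lam + 1) × Fin (lam * G.maxWeight + 1) × Bool)) := rfl
  rw [h]
  simp

variable (G lam U hT r ρ) in
/-- The state of player 2 at the `n`-th vertex of a play. -/
noncomputable def defendStateAt (n : ℕ) : ℕ × ℕ × Bool :=
  let m : Option (V × Fin (lam + 1) × Fin (lam * G.maxWeight + 1) × Bool) :=
    (G.defender lam U hT r).memory ρ n
  G.defendState lam U r (m.map fun x => (x.1, x.2.1, x.2.2.1, x.2.2.2)) (ρ n)

variable (G lam U hT r ρ) in
/-- Player 2 starts anew at the position `t`. -/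
def DefendCut (t : ℕ) : Prop := G.defendStateAt lam U hT r ρ t = (lam, 0, !U (ρ t))

theorem defendCut_zero : G.DefendCut lam U hT r ρ 0 := rfl

theorem defendStateAt_succ {n l θ : ℕ} {b : Bool}
    (h : G.defendStateAt lam U hT r ρ n = (l, θ, b)) (hl : l ≤ lam) (hθ : θ ≤ lam * G.maxWeight) :
    G.defendStateAt lam U hT r ρ (n + 1) =
      G.defendState lam U r (some (ρ n, l, θ, b)) (ρ (n + 1)) := by
  have h' : G.defendStateAt lam U hT r ρ (n + 1) = G.defendState lam U r (some (ρ n,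
      (Fin.ofNat (lam + 1) (G.defendStateAt lam U hT r ρ n).1).val,
      (Fin.ofNat (lam * G.maxWeight + 1) (G.defendStateAt lam U hT r ρ n).2.1).val,
      (G.defendStateAt lam U hT r ρ n).2.2)) (ρ (n + 1)) := rfl
  rw [h', h, Fin.val_ofNat, Fin.val_ofNat, Nat.mod_eq_of_lt (Nat.lt_succ_iff.2 hl),
    Nat.mod_eq_of_lt (Nat.lt_succ_iff.2 hθ)]

theorem defend_advances (hρ : (G.defender lam U hT r).Follows ρ) {n l θ : ℕ} {b : Bool}
    (h : G.defendStateAt lam U hT r ρ n = (l + 1, θ, b)) {k : ι}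
    (hk : ¬(G.addBit U).Force (T k) (l + 1) (ρ n, b) θ) :
    ¬(G.addBit U).Advances (T k) ((G.addBit U).Force (T k) l) (ρ n, b) θ
      (ρ (n + 1), b || !U (ρ (n + 1))) := by
  cases hv : G.owner (ρ n) with
  | one =>
    rw [force_succ_one _ (show (G.addBit U).owner (ρ n, b) = .one from hv)] at hk
    exact fun hadv => hk ⟨_, (G.mem_addBit_edges U).2 ⟨hρ.mem_plays n, rfl⟩, hadv⟩
  | two =>
    have hnext : ρ (n + 1) = (G.exists_defend_edge U hT
        ((G.defendStateAt lam U hT r ρ n).1 - 1) (ρ n) (G.defendStateAt lam U hT r ρ n).2.1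
        (G.defendStateAt lam U hT r ρ n).2.2).choose := hρ.next_eq n hv
    rw [h] at hnext
    have := (G.exists_defend_edge U hT l (ρ n) θ b).choose_spec.2 hv k hk
    rwa [← show ρ (n + 1) = _ from hnext] at this

variable (G lam U hT r ρ) in
/-- The invariant of player 2 in a window opened at `t`.  The debt at `n` is that of some position
`k` from `t` to `n`, and if player 2 starts anew at the first closing, then `k = t`. -/
def DefendInv (t n : ℕ) : Prop :=
  ∃ (k θ : ℕ) (b : Bool), t ≤ k ∧ k ≤ n ∧ (θ : ℤ) = -G.TP ρ k n ∧ (r = true → k = t) ∧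
    G.defendStateAt lam U hT r ρ n = (lam - (n - t), θ, b) ∧
    (b = true → ∃ i, t ≤ i ∧ i ≤ n ∧ U (ρ i) = false) ∧
    ∀ j, ¬(G.addBit U).Force (T j) lam (ρ t, !U (ρ t)) 0 →
      ¬(G.addBit U).Force (T j) (lam - (n - t)) (ρ n, b) θ

theorem DefendCut.inv {t : ℕ} (h : G.DefendCut lam U hT r ρ t) :
    G.DefendInv lam U hT r ρ t t := by
  refine ⟨t, 0, !U (ρ t), le_rfl, le_rfl, by simp [TP_self], fun _ => rfl, ?_, fun hb => ?_,
    fun j hj => ?_⟩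
  · rw [Nat.sub_self]; exact h
  · exact ⟨t, le_rfl, le_rfl, by simpa using hb⟩
  · rwa [Nat.sub_self]

theorem DefendInv.step (hρ : (G.defender lam U hT r).Follows ρ) {t n : ℕ}
    (h : G.DefendInv lam U hT r ρ t n) (htn : t ≤ n) (hn : n < t + lam) :
    ((r = true → G.TP ρ t (n + 1) < 0) → G.DefendInv lam U hT r ρ t (n + 1)) ∧
    (0 ≤ G.TP ρ t (n + 1) → r = true → G.DefendCut lam U hT r ρ (n + 1)) ∧
    ((∀ k, t ≤ k → k < n + 1 → 0 ≤ G.TP ρ k (n + 1)) →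
      ∃ b, (b = true → ∃ i, t ≤ i ∧ i ≤ n + 1 ∧ U (ρ i) = false) ∧
        ∀ j, ¬(G.addBit U).Force (T j) lam (ρ t, !U (ρ t)) 0 → (ρ (n + 1), b) ∉ T j) := by
  obtain ⟨k, θ, b, htk, hkn, hθ, hr, hs, hb, hF⟩ := h
  obtain ⟨l, hl⟩ : ∃ l, lam - (n - t) = l + 1 := ⟨lam - (n - t) - 1, by omega⟩
  have hl' : lam - (n + 1 - t) = l := by omega
  rw [hl] at hs hF
  have hθle : θ ≤ lam * G.maxWeight := by
    have h1 := G.neg_TP_le hρ.mem_plays k (n - k)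
    rw [Nat.add_sub_cancel' hkn, ← hθ] at h1
    have h2 : θ ≤ (n - k) * G.maxWeight := by exact_mod_cast h1
    exact h2.trans (Nat.mul_le_mul_right _ (by omega))
  have hs' := defendStateAt_succ hs (by omega) hθle
  have hadv := fun j hj => defend_advances hρ hs (hF j hj)
  have hTP := TP_succ G ρ hkn
  have hb' : (b || !U (ρ (n + 1))) = true → ∃ i, t ≤ i ∧ i ≤ n + 1 ∧ U (ρ i) = false := by
    intro h
    rcases Bool.or_eq_true_iff.1 h with h | h
    · obtain ⟨i, h1, h2, h3⟩ := hb h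
      exact ⟨i, h1, by omega, h3⟩
    · exact ⟨n + 1, by omega, le_rfl, by simpa using h⟩
  refine ⟨fun hneg => ?_, fun hnn hr' => ?_, fun hnn => ⟨_, hb', fun j hj hmem => ?_⟩⟩
  · have hno : ¬(r = true ∧ (θ : ℤ) ≤ G.w (ρ n) (ρ (n + 1))) := by
      rintro ⟨h1, h2⟩
      have h3 := hneg h1
      rw [← hr h1] at h3
      omega
    rw [show G.defendState lam U r (some (ρ n, l + 1, θ, b)) (ρ (n + 1)) = _ from if_neg hno] at hs'
    have hs'' : G.defendStateAt lam U hT r ρ (n + 1) = (lam - (n + 1 - t),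
        ((θ : ℤ) - G.w (ρ n) (ρ (n + 1))).toNat, b || !U (ρ (n + 1))) := by
      rw [hs', hl']; rfl
    have hF' : ∀ j, ¬(G.addBit U).Force (T j) lam (ρ t, !U (ρ t)) 0 →
        ¬(G.addBit U).Force (T j) (lam - (n + 1 - t)) (ρ (n + 1), b || !U (ρ (n + 1)))
          ((θ : ℤ) - G.w (ρ n) (ρ (n + 1))).toNat := by
      intro j hj h
      rw [hl'] at h
      exact hadv j hj (Or.inr h)
    by_cases hpos : 0 ≤ (θ : ℤ) - G.w (ρ n) (ρ (n + 1))
    · exact ⟨k, _, _, htk, by omega, by omega, hr, hs'', hb', hF'⟩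
    · refine ⟨n + 1, _, _, by omega, le_rfl, ?_, fun h => ?_, hs'', hb', hF'⟩
      · rw [TP_self]; omega
      · exact (hno ⟨h, by omega⟩).elim
  · rw [← hr hr'] at hnn
    exact hs'.trans (if_pos ⟨hr', by omega⟩)
  · have := hnn k htk (by omega)
    exact hadv j hj (Or.inl ⟨hmem, show (θ : ℤ) ≤ G.w (ρ n) (ρ (n + 1)) by omega⟩)

/-- If player 2 does not start anew, no inductive closure of the first window is in a target that
could be avoided. -/
theorem defend_once (hρ : (G.defender lam U hT false).Follows ρ) {m : ℕ}
    (hm : G.InductivelyClosed lam ρ 0 m) :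
    ∃ b, (b = true → ∃ i, i ≤ m ∧ U (ρ i) = false) ∧
      ∀ j, ¬(G.addBit U).Force (T j) lam (ρ 0, !U (ρ 0)) 0 → (ρ m, b) ∉ T j := by
  have hinv : ∀ n, n ≤ lam → G.DefendInv lam U hT false ρ 0 n := by
    intro n
    induction n with
    | zero => intro _; exact defendCut_zero.inv
    | succ n ih =>
      intro hn
      exact ((ih (by omega)).step hρ (Nat.zero_le _) (by omega)).1 (by simp)
  obtain ⟨h1, h2, h3⟩ := (G.inductivelyClosed_iff).1 hm
  obtain ⟨n, rfl⟩ := Nat.exists_eq_add_of_lt h1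
  rw [zero_add] at *
  obtain ⟨b, hb, h⟩ := ((hinv n (by omega)).step hρ (Nat.zero_le _) (by omega)).2.2 h3
  refine ⟨b, fun hb' => ?_, h⟩
  obtain ⟨i, -, h4, h5⟩ := hb hb'
  exact ⟨i, h4, h5⟩

/-- If player 2 starts anew at each first closing, no first closing of a window is in a target
that could be avoided. -/
theorem DefendCut.next (hρ : (G.defender lam U hT true).Follows ρ) {t m : ℕ}
    (ht : G.DefendCut lam U hT true ρ t) (hm : G.FirstClosed lam ρ t m) :
    G.DefendCut lam U hT true ρ m ∧
    ∃ b, (b = true → ∃ i, t ≤ i ∧ i ≤ m ∧ U (ρ i) = false) ∧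
      ∀ j, ¬(G.addBit U).Force (T j) lam (ρ t, !U (ρ t)) 0 → (ρ m, b) ∉ T j := by
  obtain ⟨⟨h1, h2, h3⟩, h4⟩ := hm
  have hinv : ∀ n, t + n < m → G.DefendInv lam U hT true ρ t (t + n) := by
    intro n
    induction n with
    | zero => intro _; exact ht.inv
    | succ n ih =>
      intro hn
      exact ((ih (by omega)).step hρ (by omega) (by omega)).1 fun _ => h4 _ (by omega) hn
  obtain ⟨n, rfl⟩ := Nat.exists_eq_add_of_lt h1
  obtain ⟨-, g1, g2⟩ := (hinv n (by omega)).step hρ (by omega) (by omega)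
  refine ⟨g1 h3 rfl, g2 fun k hk hkn => ?_⟩
  rcases hk.eq_or_lt with rfl | hk
  · exact h3
  · have := h4 k hk hkn
    have := TP_add G ρ hk.le hkn.le
    omega

end Defender

end Game

/-! ### The winning sets -/

namespace Game

theorem exists_gdIter_succ {V : Type} [Fintype V] (G : Game V) (lam : ℕ) {X : Set V} {v : V}
    (h : v ∈ G.gdSet lam X) (hX : v ∉ X) :
    ∃ j, v ∉ G.gdIter lam X j ∧ v ∈ G.gdIter lam X (j + 1) := by
  by_contra hcon
  push Not at hcon
  suffices ∀ j, v ∉ G.gdIter lam X j from this _ h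
  intro j
  induction j with
  | zero => exact hX
  | succ j ih => exact hcon j ih

variable {V : Type} [DecidableEq V] [Fintype V] (G : Game V) (lam : ℕ) (U : V → Bool)

/-- The target of player 1 at `v` for the objective `FObj lam U X`: the next approximation of
`gdSet` if `v` is in that set. -/
def fTarget (X : Set V) (v : V) : Set (V × Bool) :=
  {x | (∃ j, v ∉ G.gdIter lam X j ∧ v ∈ G.gdIter lam X (j + 1) ∧ x.1 ∈ G.gdIter lam X j) ∨
    (v ∉ G.gdSet lam X ∧ x ∈ endTarget (G.gdSet lam X) (G.fSet lam U X))}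

variable {G lam U}

theorem force_fTarget {X : Set V} {v : V} (h : v ∈ G.fSet lam U X) (hX : v ∉ X) :
    (G.addBit U).Force (G.fTarget lam U X v) lam (v, !U v) 0 := by
  by_cases hR : v ∈ G.gdSet lam X
  · obtain ⟨j, h1, h2⟩ := G.exists_gdIter_succ lam hR hX
    have h3 := h2
    rw [gdIter_succ] at h3
    have h4 : G.Force (G.gdIter lam X j) lam v 0 := h3.resolve_left h1
    rw [← force_addBit_fst G U (x := (v, !U v))] at h4
    exact h4.mono (fun x hx => Or.inl ⟨j, h1, h2, hx⟩) le_rfl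
  · rw [← union_endSet_fSet] at h
    have h4 := h.resolve_left hX
    exact Force.mono (fun x hx => Or.inr ⟨hR, hx⟩) le_rfl h4

theorem mem_gdIter_of_mem_fTarget {X : Set V} {v : V} {j : ℕ}
    (h' : v ∈ G.gdIter lam X (j + 1)) (hR : v ∈ G.gdSet lam X) {x : V × Bool}
    (hx : x ∈ G.fTarget lam U X v) : x.1 ∈ G.gdIter lam X j := by
  rcases hx with ⟨i, h1, h2, h3⟩ | ⟨h1, -⟩
  · have : i < j + 1 := by
      by_contra hcon
      exact h1 (G.gdIter_mono lam X (not_lt.1 hcon) h')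
    exact G.gdIter_mono lam X (Nat.lt_succ_iff.1 this) h3
  · exact (h1 hR).elim

theorem mem_endTarget_of_mem_fTarget {X : Set V} {v : V} (hR : v ∉ G.gdSet lam X) {x : V × Bool}
    (hx : x ∈ G.fTarget lam U X v) : x ∈ endTarget (G.gdSet lam X) (G.fSet lam U X) := by
  rcases hx with ⟨i, h1, h2, h3⟩ | ⟨-, h⟩
  · refine (hR ?_).elim
    have hXR : ∀ j, G.gdIter lam X j ⊆ G.gdSet lam X := by
      intro j
      induction j with
      | zero => exact G.subset_gdSet lam X
      | succ j ih =>
        rw [gdIter_succ, ← union_icw_gdSet]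
        exact G.union_icw_mono lam ih
    exact hXR _ h2
  · exact h

/-- The windows of player 1 for `FObj lam U X` either lead to `X` or go on forever within `U`. -/
theorem exists_mem_or_forall_closed {X : Set V} {ρ : ℕ → V} {P : ℕ → Prop}
    (hP : ∀ t, P t → ρ t ∈ G.fSet lam U X → ρ t ∉ X → ∃ m, G.InductivelyClosed lam ρ t m ∧ P m ∧
      ∃ c, (ρ m, c) ∈ G.fTarget lam U X (ρ t) ∧
        (c = false → ∀ i, t ≤ i → i ≤ m → U (ρ i) = true))
    {t₀ : ℕ} (h₀ : P t₀) (h₀' : ρ t₀ ∈ G.fSet lam U X) :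
    (∃ t, P t ∧ ρ t ∈ X) ∨ ∀ k, t₀ ≤ k → (∃ m, G.Closed lam ρ k m) ∧ U (ρ k) = true := by
  rw [or_iff_not_imp_left]
  intro hX
  have hX : ∀ t, P t → ρ t ∉ X := fun t h1 h2 => hX ⟨t, h1, h2⟩
  have hgd : ∀ j t, j ≤ Fintype.card V → P t → ρ t ∉ G.gdIter lam X j := by
    intro j
    induction j with
    | zero => exact fun t _ => hX t
    | succ j ih =>
      intro t hj ht hmem
      have hR := G.gdIter_mono lam X hj hmem
      obtain ⟨m, -, hm, c, hc, -⟩ := hP t ht (G.gdSet_subset_fSet lam U X hR) (hX t ht)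
      exact ih m (by omega) hm
        (mem_gdIter_of_mem_fTarget hmem hR hc)
  refine forall_closed_of_cuts (P := fun t => P t ∧ ρ t ∈ G.fSet lam U X) ⟨h₀, h₀'⟩ ?_
  rintro t - ⟨ht, hmem⟩
  obtain ⟨m, h1, hm, c, hc, hc'⟩ := hP t ht hmem (hX t ht)
  rcases mem_endTarget_of_mem_fTarget (hgd _ t le_rfl ht) hc with h | ⟨h2, h3⟩
  · exact (hgd _ m le_rfl hm h).elim
  · exact ⟨m, h1, ⟨hm, h2⟩, hc' h3⟩

/-! ### Player 2 in the game for `FObj` -/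

/-- The decreasing family of targets that player 2 avoids.  The one at `⊤` is `gdSet` alone; it
serves him at the vertices of `fSet`, where only `GDReach` can be prevented. -/
def fAvoid (G : Game V) (lam : ℕ) (U : V → Bool) (X : Set V) (k : WithTop ℕ) : Set (V × Bool) :=
  {x | x.1 ∈ G.gdSet lam X ∨ ∃ m : ℕ, k = m ∧ x.1 ∈ G.fIter lam U X m ∧ x.2 = false}

theorem fAvoid_antitone (G : Game V) (lam : ℕ) (U : V → Bool) (X : Set V) :
    Antitone (G.fAvoid lam U X) := by
  rintro k k' hk x (h | ⟨m, rfl, h1, h2⟩)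
  · exact Or.inl h
  · obtain ⟨n, rfl⟩ := WithTop.ne_top_iff_exists.1 (ne_top_of_le_ne_top (WithTop.coe_ne_top) hk)
    exact Or.inr ⟨n, rfl, G.fIter_antitone lam U X (WithTop.coe_le_coe.1 hk) h1, h2⟩

section Defend

variable {X : Set V} {ρ : ℕ → V}

theorem DefendCut.notMem_gdSet
    (hρ : (G.defender lam U (G.fAvoid_antitone lam U X) true).Follows ρ) {t m : ℕ}
    (h : G.DefendCut lam U (G.fAvoid_antitone lam U X) true ρ t ∧ ρ t ∉ G.gdSet lam X)
    (hm : G.FirstClosed lam ρ t m) :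
    G.DefendCut lam U (G.fAvoid_antitone lam U X) true ρ m ∧ ρ m ∉ G.gdSet lam X := by
  obtain ⟨h1, b, -, h2⟩ := h.1.next hρ hm
  refine ⟨h1, fun hmem => h2 ⊤ ?_ (Or.inl hmem)⟩
  intro hF
  have hT : G.fAvoid lam U X ⊤ = {x | x.1 ∈ G.gdSet lam X} := by
    ext x
    refine or_iff_left ?_
    rintro ⟨m, h, -⟩
    exact WithTop.top_ne_coe h
  rw [hT, force_addBit_fst] at hF
  exact h.2 ((G.union_icw_gdSet lam X).subset (Or.inr hF))

theorem DefendCut.notMem_fIter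
    (hρ : (G.defender lam U (G.fAvoid_antitone lam U X) true).Follows ρ) {t m k : ℕ}
    (h : G.DefendCut lam U (G.fAvoid_antitone lam U X) true ρ t)
    (hk : ρ t ∉ G.fIter lam U X (k + 1))
    (hm : G.FirstClosed lam ρ t m) (hU : ∀ i, t ≤ i → i ≤ m → U (ρ i) = true) :
    ρ m ∉ G.fIter lam U X k := by
  obtain ⟨-, b, hb, h2⟩ := h.next hρ hm
  have hb' : b = false := by
    by_contra hb'
    obtain ⟨i, h3, h4, h5⟩ := hb (by simpa using hb')
    rw [hU i h3 h4] at h5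
    exact Bool.noConfusion h5
  refine fun hmem => h2 k (fun hF => hk ?_) (Or.inr ⟨k, rfl, hmem, hb'⟩)
  rw [fIter_succ]
  refine Or.inr (hF.mono ?_ le_rfl)
  rintro x (h | ⟨m, h3, h4, h5⟩)
  · exact Or.inl h
  · obtain rfl := WithTop.coe_injective h3
    exact Or.inr ⟨h4, h5⟩

/-- From the complement of `gdSet`, player 2 prevents `GDReach lam X`. -/
theorem notMem_GDReach_of_follows
    (hρ : (G.defender lam U (G.fAvoid_antitone lam U X) true).Follows ρ)
    (h0 : ρ 0 ∉ G.gdSet lam X) : ρ ∉ G.GDReach lam X := by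
  rintro ⟨-, l, hl, hgd⟩
  have := hgd.of_firstClosed (fun t m h hm => DefendCut.notMem_gdSet hρ h hm)
    ⟨defendCut_zero, h0⟩
  exact this.2 (G.subset_gdSet lam X hl)

/-- If player 2 opens a window off `fIter k` and the play then remains in `U`, each window that
closes decreases `k`, so that some window never closes. -/
theorem exists_not_closed_of_follows
    (hρ : (G.defender lam U (G.fAvoid_antitone lam U X) true).Follows ρ)
    (k : ℕ) {t : ℕ} (ht : G.DefendCut lam U (G.fAvoid_antitone lam U X) true ρ t)
    (htk : ρ t ∉ G.fIter lam U X k) (hU : ∀ i, t ≤ i → U (ρ i) = true) :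
    ∃ k, ∀ m, ¬G.Closed lam ρ k m := by
  by_contra hcon
  push Not at hcon
  induction k generalizing t with
  | zero => exact htk (Set.mem_univ _)
  | succ k ih =>
    obtain ⟨m, hm⟩ := hcon t
    obtain ⟨m, -, hm⟩ := hm.exists_firstClosed
    exact ih (ht.next hρ hm).1 (ht.notMem_fIter hρ htk hm fun i h _ => hU i h)
      fun i hi => hU i (hm.1.1.le.trans hi)

end Defend

theorem winningSet_GDReach [Nonempty V] (G : Game V) (lam : ℕ) (X : Set V) :
    G.winningSet .one (G.GDReach lam X) = G.gdSet lam X := by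
  -- the winning set does not depend on `U`, so that the strategies for `FObj` can be used
  let U : V → Bool := fun _ => true
  refine Set.Subset.antisymm (fun v hv => ?_) (fun v hv => ?_)
  · by_contra hR
    let A := G.defender lam U (G.fAvoid_antitone lam U X) true
    refine notMem_winningSet_one A.strategy (fun σ => ?_) hv
    exact notMem_GDReach_of_follows (A.follows_outcome _ v) hR
  · let A := G.attacker lam U (G.fTarget lam U X)
    refine ⟨A.strategy, A.winsFrom fun ρ hρ h0 => ⟨hρ.mem_plays, ?_⟩⟩
    by_contra hcon
    have hgd : ∀ j t, j ≤ Fintype.card V → G.AttackCut lam U (G.fTarget lam U X) ρ t →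
        G.HasGoodDecomposition lam ρ t → ρ t ∉ G.gdIter lam X j := by
      intro j
      induction j with
      | zero => exact fun t _ _ ht h => hcon ⟨t, h, ht⟩
      | succ j ih =>
        intro t hj ht htg hmem
        have hR := G.gdIter_mono lam X hj hmem
        obtain ⟨m, hm, hm', c, hc, -⟩ := ht.exists_next hρ
          (force_fTarget (G.gdSet_subset_fSet lam U X hR) fun h => hcon ⟨t, h, htg⟩)
        exact ih m (by omega) hm' (htg.append hm)
          (mem_gdIter_of_mem_fTarget hmem hR hc)
    exact hgd _ 0 le_rfl attackCut_zero (hasGoodDecomposition_zero lam ρ) (h0 ▸ hv)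

theorem winningSet_FObj [Nonempty V] (G : Game V) (lam : ℕ) (U : V → Bool) (X : Set V) :
    G.winningSet .one (G.FObj lam {v | U v = true} X) = G.fSet lam U X := by
  refine Set.Subset.antisymm (fun v hv => ?_) (fun v hv => ?_)
  · by_contra hZ
    let A := G.defender lam U (G.fAvoid_antitone lam U X) true
    refine notMem_winningSet_one A.strategy (fun σ => ?_) hv
    have hρ := A.follows_outcome σ v
    rintro (⟨h1, h2⟩ | h)
    · obtain ⟨k, hk⟩ := exists_not_closed_of_follows hρ _ defendCut_zero hZ fun i _ => h2.2 i
      obtain ⟨m, hm⟩ := (G.mem_WMP_iff.1 h1).2 k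
      exact hk m hm
    · exact notMem_GDReach_of_follows hρ (fun h => hZ (G.gdSet_subset_fSet lam U X h)) h
  · let A := G.attacker lam U (G.fTarget lam U X)
    refine ⟨A.strategy, A.winsFrom fun ρ hρ h0 => ?_⟩
    have hnext : ∀ t, G.AttackCut lam U (G.fTarget lam U X) ρ t ∧ G.HasGoodDecomposition lam ρ t →
        ρ t ∈ G.fSet lam U X → ρ t ∉ X → ∃ m, G.InductivelyClosed lam ρ t m ∧
          (G.AttackCut lam U (G.fTarget lam U X) ρ m ∧ G.HasGoodDecomposition lam ρ m) ∧
          ∃ c, (ρ m, c) ∈ G.fTarget lam U X (ρ t) ∧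
            (c = false → ∀ i, t ≤ i → i ≤ m → U (ρ i) = true) := by
      intro t ht hZ hX
      obtain ⟨m, hm, hm', h⟩ := ht.1.exists_next hρ (force_fTarget hZ hX)
      exact ⟨m, hm, ⟨hm', ht.2.append hm⟩, h⟩
    rcases exists_mem_or_forall_closed hnext (t₀ := 0)
      ⟨attackCut_zero, hasGoodDecomposition_zero lam ρ⟩ (h0 ▸ hv) with ⟨t, ht, htX⟩ | h
    · exact Or.inr ⟨hρ.mem_plays, t, htX, ht.2⟩
    · exact Or.inl ⟨G.mem_WMP_iff.2 ⟨hρ.mem_plays, fun k => (h k (Nat.zero_le _)).1⟩,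
        hρ.mem_plays, fun k => (h k (Nat.zero_le _)).2⟩

theorem winningSet_EndObj [Nonempty V] (G : Game V) (lam : ℕ) (U : V → Bool) (X Z : Set V) :
    G.winningSet .one (G.EndObj lam {v | U v = true} X Z) =
      G.endSet lam U (G.gdSet lam X) Z := by
  refine Set.Subset.antisymm (fun v hv => ?_) (fun v hv => ?_)
  · by_contra hE
    let T : Unit → Set (V × Bool) := fun _ => endTarget (G.gdSet lam X) Z
    let A := G.defender lam U (T := T) antitone_const false
    refine notMem_winningSet_one A.strategy (fun σ => ?_) hv
    have hρ := A.follows_outcome σ v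
    rintro ⟨-, l, -, -, hic, h⟩
    rw [winningSet_GDReach] at h
    obtain ⟨b, hb, h'⟩ := defend_once hρ hic
    refine h' () hE ?_
    rcases h with h | ⟨h, hU⟩
    · exact Or.inl h
    · refine Or.inr ⟨h, ?_⟩
      by_contra hb'
      obtain ⟨i, h1, h2⟩ := hb (by simpa using hb')
      have h3 : U _ = true := hU i h1
      rw [h3] at h2
      exact Bool.noConfusion h2
  · let T : V → Set (V × Bool) := fun _ => endTarget (G.gdSet lam X) Z
    let A := G.attacker lam U T
    refine ⟨A.strategy, A.winsFrom fun ρ hρ h0 => ⟨hρ.mem_plays, ?_⟩⟩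
    obtain ⟨m, hm, -, c, hc, hU⟩ := (attackCut_zero (T := T)).exists_next hρ (h0 ▸ hv)
    refine ⟨m, hm.1.1, by simpa using hm.1.2.1, hm, ?_⟩
    rw [winningSet_GDReach]
    rcases hc with h | ⟨h1, h2⟩
    · exact Or.inl h
    · exact Or.inr ⟨h1, fun i hi => hU h2 i (Nat.zero_le _) hi⟩

theorem isGreatest_fSet (G : Game V) (lam : ℕ) (U : V → Bool) (X : Set V) :
    IsGreatest {Z | X ∪ G.endSet lam U (G.gdSet lam X) Z = Z} (G.fSet lam U X) :=
  ⟨G.union_endSet_fSet lam U X, fun _ hZ => G.subset_fIter lam U (Eq.ge hZ) _⟩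

theorem isLeast_winSet (G : Game V) (lam : ℕ) (U : V → Bool) :
    IsLeast {X | G.fSet lam U X = X} (G.winSet lam U) :=
  ⟨G.fSet_winSet lam U, fun _ hX => G.winSet_subset lam U (Eq.le hX)⟩

/-! ### The window mean-payoff objective with the co-Büchi condition -/

theorem eventually_of_mem_CoBuchi {V : Type} [Fintype V] {G : Game V} {U : V → Bool} {ρ : ℕ → V}
    (h : ρ ∈ G.CoBuchi {v | U v = true}) :
    ∃ N, ∀ k, N ≤ k → U (ρ k) = true := by
  have hfin : {k | U (ρ k) = false}.Finite := by
    have : {k | U (ρ k) = false} ⊆ ⋃ v ∈ {v | U v = false}, {k | ρ k = v} := by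
      intro k hk
      exact Set.mem_biUnion (x := ρ k) hk rfl
    refine Set.Finite.subset (Set.Finite.biUnion (Set.toFinite _) fun v hv => ?_) this
    refine Set.not_infinite.1 (h.2 v ?_)
    intro hv'
    rw [Set.mem_ofPred_eq] at hv hv'
    rw [hv] at hv'
    exact Bool.noConfusion hv'
  obtain ⟨N, hN⟩ := hfin.bddAbove
  refine ⟨N + 1, fun k hk => ?_⟩
  by_contra hcon
  have := hN (show U (ρ k) = false by simpa using hcon)
  omega

theorem mem_CoBuchi_of_eventually {V : Type} {G : Game V} {U : V → Bool} {ρ : ℕ → V}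
    (hρ : ρ ∈ G.Plays) {N : ℕ}
    (h : ∀ k, N ≤ k → U (ρ k) = true) : ρ ∈ G.CoBuchi {v | U v = true} := by
  refine ⟨hρ, fun v hv hinf => ?_⟩
  obtain ⟨k, hk, hlt⟩ := hinf.exists_gt N
  rw [Set.mem_ofPred_eq] at hk
  exact hv (hk ▸ h k hlt.le)

/-- The target of player 1 at `v` for the window mean-payoff objective with the co-Büchi condition:
her target for `FObj` on the last approximation that does not yet contain `v`. -/
def winTarget (G : Game V) (lam : ℕ) (U : V → Bool) (v : V) : Set (V × Bool) :=
  {x | ∃ i, v ∉ G.winIter lam U i ∧ v ∈ G.winIter lam U (i + 1) ∧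
    x ∈ G.fTarget lam U (G.winIter lam U i) v}

theorem force_winTarget {i : ℕ} {v : V} (h : v ∉ G.winIter lam U i)
    (h' : v ∈ G.winIter lam U (i + 1)) :
    (G.addBit U).Force (G.winTarget lam U v) lam (v, !U v) 0 := by
  have h2 := h'
  rw [winIter_succ] at h2
  exact Force.mono (T' := G.winTarget lam U v) (fun x hx => ⟨i, h, h', hx⟩) le_rfl
    (force_fTarget (h2.resolve_left h) h)

theorem mem_fTarget_of_mem_winTarget {i : ℕ} {v : V} (h : v ∉ G.winIter lam U i)
    (h' : v ∈ G.winIter lam U (i + 1)) {x : V × Bool} (hx : x ∈ G.winTarget lam U v) :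
    x ∈ G.fTarget lam U (G.winIter lam U i) v := by
  obtain ⟨j, h1, h2, h3⟩ := hx
  have hij : ∀ {a b : ℕ}, v ∉ G.winIter lam U a → v ∈ G.winIter lam U (b + 1) → a ≤ b := by
    intro a b ha hb
    by_contra hcon
    exact ha (G.winIter_mono lam U (by omega) hb)
  obtain rfl := le_antisymm (hij h h2) (hij h1 h')
  exact h3

theorem exists_winIter_succ {i : ℕ} {v : V} (h : v ∈ G.winIter lam U i) :
    ∃ j, j < i ∧ v ∉ G.winIter lam U j ∧ v ∈ G.winIter lam U (j + 1) := by
  induction i with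
  | zero => exact (Set.notMem_empty v h).elim
  | succ i ih =>
    by_cases hi : v ∈ G.winIter lam U i
    · obtain ⟨j, h1, h2⟩ := ih hi
      exact ⟨j, by omega, h2⟩
    · exact ⟨i, by omega, hi, h⟩

theorem fTarget_fst_mem_winIter {i : ℕ} {v : V} (h : v ∉ G.winIter lam U i)
    {x : V × Bool}
    (hx : x ∈ G.fTarget lam U (G.winIter lam U i) v) : x.1 ∈ G.winIter lam U (i + 1) := by
  have hR := G.gdSet_subset_fSet lam U (G.winIter lam U i)
  have hZ : G.fSet lam U (G.winIter lam U i) ⊆ G.winIter lam U (i + 1) := by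
    rw [winIter_succ]; exact Set.subset_union_right
  by_cases hv : v ∈ G.gdSet lam (G.winIter lam U i)
  · obtain ⟨j, h1, h2⟩ := G.exists_gdIter_succ lam hv h
    rcases hx with ⟨j, h1, h2, h3⟩ | ⟨h1, -⟩
    · refine hZ (hR ?_)
      by_contra hcon
      have hle : j ≤ Fintype.card V := by
        by_contra hj
        exact h1 (G.gdIter_mono lam _ (by omega) hv)
      exact hcon (G.gdIter_mono lam _ hle h3)
    · exact (h1 hv).elim
  · rcases mem_endTarget_of_mem_fTarget hv hx with h | ⟨h, -⟩
    exacts [hZ (hR h), hZ h]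

/-- The windows that player 1 opens in `winSet` close, and from some position on they stay in `U`,
as the index of the approximation cannot decrease forever. -/
theorem mem_objective_of_attacker [Nonempty V] {ρ : ℕ → V}
    (hρ : (G.attacker lam U (G.winTarget lam U)).Follows ρ) (h0 : ρ 0 ∈ G.winSet lam U) :
    ρ ∈ G.WMP lam ∩ G.CoBuchi {v | U v = true} := by
  set P := G.AttackCut lam U (G.winTarget lam U) ρ with hP
  have hnext : ∀ i t, P t → ρ t ∉ G.winIter lam U i → ρ t ∈ G.winIter lam U (i + 1) →
      ∃ m, G.InductivelyClosed lam ρ t m ∧ P m ∧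
        ∃ c, (ρ m, c) ∈ G.fTarget lam U (G.winIter lam U i) (ρ t) ∧
          (c = false → ∀ i, t ≤ i → i ≤ m → U (ρ i) = true) := by
    intro i t ht h1 h2
    obtain ⟨m, hm, hm', c, hc, hc'⟩ := ht.exists_next hρ (force_winTarget h1 h2)
    exact ⟨m, hm, hm', c, mem_fTarget_of_mem_winTarget h1 h2 hc, hc'⟩
  refine ⟨G.mem_WMP_iff.2 ⟨hρ.mem_plays, fun k => ?_⟩, ?_⟩
  · refine (forall_closed_of_cuts (P := fun t => P t ∧ ρ t ∈ G.winSet lam U)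
      (S := fun _ => True) (t₀ := 0) ⟨attackCut_zero, h0⟩ ?_ k (Nat.zero_le _)).1
    rintro t - ⟨ht, htw⟩
    obtain ⟨j, hj, h1, h2⟩ := exists_winIter_succ htw
    obtain ⟨m, hm, hm', c, hc, -⟩ := hnext j t ht h1 h2
    exact ⟨m, hm, ⟨hm', G.winIter_mono lam U hj (fTarget_fst_mem_winIter h1 hc)⟩,
      fun _ _ _ => trivial⟩
  · have key : ∀ i t, P t → ρ t ∈ G.winIter lam U i → ∃ N, ∀ k, N ≤ k → U (ρ k) = true := by
      intro i
      induction i with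
      | zero => exact fun t _ h => (Set.notMem_empty _ h).elim
      | succ i ih =>
        intro t ht hi
        have hsub : G.fSet lam U (G.winIter lam U i) ⊆ G.winIter lam U (i + 1) := by
          rw [winIter_succ]; exact Set.subset_union_right
        rw [winIter_succ] at hi
        rcases hi with hi | hi
        · exact ih t ht hi
        · rcases exists_mem_or_forall_closed (P := P)
            (fun s hs h1 h2 => hnext i s hs h2 (hsub h1)) ht hi with ⟨s, hs, hsX⟩ | h
          · exact ih s hs hsX
          · exact ⟨t, fun k hk => (h k hk).2⟩
    obtain ⟨N, hN⟩ := key _ 0 attackCut_zero h0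
    exact mem_CoBuchi_of_eventually hρ.mem_plays hN

/-- Off `winSet`, player 2 spoils the objective: his windows start off `winSet`, which is a
fixpoint, so `exists_not_closed_of_follows` applies at every one of them. -/
theorem notMem_objective_of_defender {ρ : ℕ → V} (hρ : (G.defender lam U
      (G.fAvoid_antitone lam U (G.winSet lam U)) true).Follows ρ)
    (h0 : ρ 0 ∉ G.winSet lam U) : ρ ∉ G.WMP lam ∩ G.CoBuchi {v | U v = true} := by
  rintro ⟨h1, h2⟩
  obtain ⟨N, hN⟩ := eventually_of_mem_CoBuchi h2
  have hcl := (G.mem_WMP_iff.1 h1).2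
  have hcut : ∀ n, ∃ t, n ≤ t ∧
      G.DefendCut lam U (G.fAvoid_antitone lam U (G.winSet lam U)) true ρ t ∧
      ρ t ∉ G.gdSet lam (G.winSet lam U) := by
    intro n
    induction n with
    | zero => exact ⟨0, le_rfl, defendCut_zero, by rwa [gdSet_winSet]⟩
    | succ n ih =>
      obtain ⟨t, hnt, ht⟩ := ih
      obtain ⟨m, hm⟩ := hcl t
      obtain ⟨m, -, hm⟩ := hm.exists_firstClosed
      have := hm.1.1
      exact ⟨m, by omega, DefendCut.notMem_gdSet hρ ht hm⟩
  obtain ⟨t, hNt, ht, htw⟩ := hcut N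
  rw [gdSet_winSet, ← fSet_winSet] at htw
  obtain ⟨k, hk⟩ := exists_not_closed_of_follows hρ _ ht htw fun i hi => hN i (hNt.trans hi)
  obtain ⟨m, hm⟩ := hcl k
  exact hk m hm

theorem winningSet_WMP_inter_CoBuchi [Nonempty V] (G : Game V) (lam : ℕ) (U : V → Bool) :
    G.winningSet .one (G.WMP lam ∩ G.CoBuchi {v | U v = true}) = G.winSet lam U := by
  refine Set.Subset.antisymm (fun v hv => ?_) (fun v hv => ?_)
  · by_contra hw
    let A := G.defender lam U (G.fAvoid_antitone lam U (G.winSet lam U)) true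
    refine notMem_winningSet_one A.strategy (fun σ => ?_) hv
    exact notMem_objective_of_defender (A.follows_outcome σ v) hw
  · exact ⟨(G.attacker lam U (G.winTarget lam U)).strategy,
      MooreMachine.winsFrom _ fun ρ hρ h0 => mem_objective_of_attacker hρ (h0 ▸ hv)⟩

/-- The winning set of player 2 is disjoint from `winSet`. -/
theorem notMem_winSet_of_mem_winningSet_two [Nonempty V] {v : V}
    (hv : v ∈ G.winningSet .two (G.Plays \ (G.WMP lam ∩ G.CoBuchi {v | U v = true}))) :
    v ∉ G.winSet lam U := by
  obtain ⟨τ, hτ⟩ := hv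
  rw [← winningSet_WMP_inter_CoBuchi]
  exact notMem_winningSet_one τ fun σ => (hτ σ).2

end Game

/-! ### Values of the algorithms -/

namespace Timed

@[simp] theorem val_bind {α β : Type} (x : Timed α) (f : α → Timed β) :
    (x >>= f).val = (f x.val).val := rfl

@[simp] theorem time_bind {α β : Type} (x : Timed α) (f : α → Timed β) :
    (x >>= f).time = x.time + (f x.val).time := rfl

@[simp] theorem val_pure {α : Type} (a : α) : (pure a : Timed α).val = a := rfl

@[simp] theorem time_pure {α : Type} (a : α) : (pure a : Timed α).time = 0 := rfl

@[simp] theorem time_tick (k : ℕ) : (tick k).time = k := rfl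

@[simp] theorem val_read {ι α : Type} (a : ι → α) (i : ι) : (read a i).val = a i := rfl

@[simp] theorem time_read {ι α : Type} (a : ι → α) (i : ι) : (read a i).time = 1 := rfl

@[simp] theorem val_write {ι α : Type} [DecidableEq ι] (a : ι → α) (i : ι) (x : α) :
    (write a i x).val = Function.update a i x := rfl

@[simp] theorem time_write {ι α : Type} [DecidableEq ι] (a : ι → α) (i : ι) (x : α) :
    (write a i x).time = 1 := rfl

@[simp] theorem time_newArray {ι α : Type} (l : List ι) (x : α) :
    (newArray l x).time = l.length + 1 := rfl

@[simp] theorem val_push {α : Type} (x : α) (l : List α) : (push x l).val = x :: l := rfl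

@[simp] theorem time_push {α : Type} (x : α) (l : List α) : (push x l).time = 1 := rfl

@[simp] theorem val_or (a b : Bool) : (Timed.or a b).val = (a || b) := rfl

@[simp] theorem time_or (a b : Bool) : (Timed.or a b).time = 1 := rfl

@[simp] theorem val_not (a : Bool) : (Timed.not a).val = !a := rfl

@[simp] theorem time_not (a : Bool) : (Timed.not a).time = 1 := rfl

theorem val_forEach {α β : Type} (l : List α) (b : β) (f : β → α → Timed β) :
    (forEach l b f).val = l.foldl (fun b a => (f b a).val) b := by
  induction l generalizing b with
  | nil => rfl
  | cons a l ih => simp [forEach, ih]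

/-- A loop that writes `g a` into the cell `a`, for each `a` in the list. -/
theorem foldl_update_apply {ι α : Type} [DecidableEq ι] (l : List ι) (g : ι → α) (a : ι → α)
    (i : ι) : l.foldl (fun a i => Function.update a i (g i)) a i = if i ∈ l then g i else a i := by
  induction l generalizing a with
  | nil => simp
  | cons j l ih =>
    rw [List.foldl_cons, ih]
    by_cases h : i ∈ l
    · simp [h]
    · by_cases hij : i = j
      · subst hij; simp [h]
      · simp [h, hij]

theorem val_forEach_write {ι α : Type} [DecidableEq ι] {l : List ι} (hl : ∀ i, i ∈ l) (a : ι → α)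
    {f : (ι → α) → ι → Timed (ι → α)} {g : ι → α}
    (hf : ∀ a i, (f a i).val = Function.update a i (g i)) : (forEach l a f).val = g := by
  rw [val_forEach]
  simp only [hf]
  funext i
  rw [foldl_update_apply, if_pos (hl i)]

end Timed

namespace WMPAlgo

open Timed

variable {V : Type}

/-- The value `a` of `ℤ ∪ {-∞}` is at least `θ`. -/
def AtLeast (a : Option ℤ) (θ : ℕ) : Prop := ∃ z, a = some z ∧ (θ : ℤ) ≤ z

theorem atLeast_max {a b : Option ℤ} {θ : ℕ} :
    AtLeast (Timed.max a b).val θ ↔ AtLeast a θ ∨ AtLeast b θ := by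
  unfold AtLeast Timed.max
  cases a with
  | none => simp
  | some x =>
    cases b with
    | none => simp
    | some y =>
      dsimp only
      split_ifs with h <;> simp <;> omega

theorem atLeast_min {a b : Option ℤ} {θ : ℕ} :
    AtLeast (Timed.min a b).val θ ↔ AtLeast a θ ∧ AtLeast b θ := by
  unfold AtLeast Timed.min
  cases a with
  | none => simp
  | some x =>
    cases b with
    | none => simp
    | some y =>
      dsimp only
      split_ifs with h <;> simp <;> omega

theorem atLeast_oplus {x : ℤ} {a : Option ℤ} {θ : ℕ} (ha : ∀ z, a = some z → 0 ≤ z) :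
    AtLeast (oplus (some x) a).val θ ↔ AtLeast a ((θ : ℤ) - x).toNat := by
  unfold AtLeast oplus
  cases a with
  | none => simp
  | some y =>
    have := ha y rfl
    dsimp only
    split_ifs with h <;> simp <;> omega

theorem val_improve_none (p : Player) (x : Option ℤ) : (improve p none x).val = some x := by
  cases p <;> rfl

theorem val_improve_one (y x : Option ℤ) :
    (improve .one (some y) x).val = some (Timed.max y x).val := rfl

theorem val_improve_two (y x : Option ℤ) :
    (improve .two (some y) x).val = some (Timed.min y x).val := rfl

/-- The value that the edge `e` contributes to `bestEdge`. -/
def edgeValue (c₀ c : V → Option ℤ) (e : V × ℤ) : Option ℤ :=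
  (oplus (some e.2) (Timed.max (c₀ e.1) (c e.1)).val).val

theorem val_bestEdge (D : GameData V) (c₀ c : V → Option ℤ) (v : V) :
    (bestEdge D c₀ c v).val = ((D.adj v).foldl
      (fun acc e => (improve (D.owner v) acc (edgeValue c₀ c e)).val) none).getD none := by
  simp only [bestEdge, val_bind, val_read, val_pure, val_forEach, edgeValue]

theorem atLeast_foldl_improve_one (f : V × ℤ → Option ℤ) (θ : ℕ) (es : List (V × ℤ))
    (acc : Option (Option ℤ)) :
    AtLeast ((es.foldl (fun acc e => (improve .one acc (f e)).val) acc).getD none) θ ↔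
      AtLeast (acc.getD none) θ ∨ ∃ e ∈ es, AtLeast (f e) θ := by
  induction es generalizing acc with
  | nil => simp
  | cons e es ih =>
    rw [List.foldl_cons, ih]
    cases acc with
    | none =>
      have : ¬AtLeast none θ := by simp [AtLeast]
      simp [val_improve_none, this]
    | some y => simp [val_improve_one, atLeast_max, or_assoc]

theorem atLeast_foldl_improve_two (f : V × ℤ → Option ℤ) (θ : ℕ) (es : List (V × ℤ))
    (y : Option ℤ) :
    AtLeast ((es.foldl (fun acc e => (improve .two acc (f e)).val) (some y)).getD none) θ ↔
      AtLeast y θ ∧ ∀ e ∈ es, AtLeast (f e) θ := by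
  induction es generalizing y with
  | nil => simp
  | cons e es ih =>
    rw [List.foldl_cons, val_improve_two, ih, atLeast_min]
    simp [and_assoc]

theorem atLeast_bestEdge_one {D : GameData V} {c₀ c : V → Option ℤ} {v : V} {θ : ℕ}
    (h : D.owner v = .one) :
    AtLeast (bestEdge D c₀ c v).val θ ↔ ∃ e ∈ D.adj v, AtLeast (edgeValue c₀ c e) θ := by
  have : ¬AtLeast none θ := by simp [AtLeast]
  rw [val_bestEdge, h, atLeast_foldl_improve_one]
  simp [this]

theorem atLeast_bestEdge_two {D : GameData V} {c₀ c : V → Option ℤ} {v : V} {θ : ℕ}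
    (h : D.owner v = .two) (hne : D.adj v ≠ []) :
    AtLeast (bestEdge D c₀ c v).val θ ↔ ∀ e ∈ D.adj v, AtLeast (edgeValue c₀ c e) θ := by
  obtain ⟨e, es, hes⟩ := List.exists_cons_of_ne_nil hne
  rw [val_bestEdge, h, hes, List.foldl_cons, val_improve_none,
    atLeast_foldl_improve_two]
  simp

/-- The initial table `C₀` of the algorithm `icwEnd`. -/
def initTable (T : V → Bool) (v : V) : Option ℤ := if T v then some 0 else none

/-- The table `C_l` of the algorithm `icwEnd`. -/
def table (D : GameData V) (T : V → Bool) : ℕ → V → Option ℤ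
  | 0 => initTable T
  | l + 1 => fun v => (bestEdge D (initTable T) (table D T l) v).val

variable {D : GameData V} {G : Game V}

theorem initTable_eq_some {T : V → Bool} {v : V} {z : ℤ} (h : initTable T v = some z) :
    T v = true ∧ z = 0 := by
  unfold initTable at h
  split_ifs at h with hT
  exact ⟨hT, (Option.some.inj h).symm⟩

theorem max_nonneg {a b : Option ℤ} (ha : ∀ z, a = some z → 0 ≤ z) (hb : ∀ z, b = some z → 0 ≤ z) :
    ∀ z, (Timed.max a b).val = some z → 0 ≤ z := by
  intro z hz
  have h : AtLeast (Timed.max a b).val 0 → 0 ≤ z := by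
    rintro ⟨z', h, h'⟩
    rw [hz] at h
    rw [Option.some.inj h]
    exact h'
  cases a with
  | some x => exact h (atLeast_max.2 (Or.inl ⟨x, rfl, ha x rfl⟩))
  | none =>
    cases b with
    | some y => exact h (atLeast_max.2 (Or.inr ⟨y, rfl, hb y rfl⟩))
    | none => exact absurd hz (by simp [Timed.max])

/-- The values `-∞` or `0 ≤ z ≤ K`. -/
def Bounded (K : ℕ) (a : Option ℤ) : Prop := ∀ z, a = some z → 0 ≤ z ∧ z ≤ K

theorem Bounded.mono {K K' : ℕ} (h : K ≤ K') {a : Option ℤ} (ha : Bounded K a) : Bounded K' a :=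
  fun z hz => ⟨(ha z hz).1, (ha z hz).2.trans (by exact_mod_cast h)⟩

theorem Bounded.max {K : ℕ} {a b : Option ℤ} (ha : Bounded K a) (hb : Bounded K b) :
    Bounded K (Timed.max a b).val := by
  unfold Timed.max
  cases a with
  | none => simpa using hb
  | some x =>
    cases b with
    | none => simpa using ha
    | some y => dsimp only; split_ifs; exacts [hb, ha]

theorem Bounded.min {K : ℕ} {a b : Option ℤ} (ha : Bounded K a) (hb : Bounded K b) :
    Bounded K (Timed.min a b).val := by
  unfold Timed.min
  cases a with
  | none => simp [Bounded]
  | some x =>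
    cases b with
    | none => simp [Bounded]
    | some y => dsimp only; split_ifs; exacts [ha, hb]

theorem Bounded.oplus {K W : ℕ} {x : ℤ} (hx : x.natAbs ≤ W) {a : Option ℤ} (ha : Bounded K a) :
    Bounded (K + W) (oplus (some x) a).val := by
  unfold Timed.oplus
  cases a with
  | none => simp [Bounded]
  | some y =>
    have := ha y rfl
    dsimp only
    split_ifs with h
    · intro z hz
      obtain rfl := Option.some.inj hz
      push_cast
      omega
    · simp [Bounded]

theorem Bounded.improve {K : ℕ} {p : Player} {acc : Option (Option ℤ)} {x : Option ℤ}
    (hacc : ∀ y, acc = some y → Bounded K y) (hx : Bounded K x) :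
    ∀ y, (improve p acc x).val = some y → Bounded K y := by
  intro y hy
  cases acc with
  | none =>
    cases p <;> simp only [WMPAlgo.improve, val_bind, val_pure, Option.some.injEq] at hy <;>
      exact hy ▸ hx
  | some a =>
    cases p <;> simp only [WMPAlgo.improve, val_bind, val_pure, Option.some.injEq] at hy
    exacts [hy ▸ (hacc a rfl).max hx, hy ▸ (hacc a rfl).min hx]

theorem Bounded.foldl_improve {K : ℕ} {p : Player} {f : V × ℤ → Option ℤ} (es : List (V × ℤ))
    (hf : ∀ e ∈ es, Bounded K (f e)) (acc : Option (Option ℤ))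
    (hacc : ∀ y, acc = some y → Bounded K y) :
    ∀ y, es.foldl (fun acc e => (WMPAlgo.improve p acc (f e)).val) acc = some y →
      Bounded K y := by
  induction es generalizing acc with
  | nil => simpa using hacc
  | cons e es ih =>
    rw [List.foldl_cons]
    exact ih (fun e' he' => hf e' (List.mem_cons_of_mem _ he')) _
      (Bounded.improve hacc (hf e List.mem_cons_self))

theorem bounded_bestEdge {K W : ℕ} {c₀ c : V → Option ℤ} {v : V} (h₀ : ∀ v, Bounded K (c₀ v))
    (h : ∀ v, Bounded K (c v)) (hW : ∀ e ∈ D.adj v, e.2.natAbs ≤ W) :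
    Bounded (K + W) (bestEdge D c₀ c v).val := by
  rw [val_bestEdge]
  have := Bounded.foldl_improve (p := D.owner v) (f := edgeValue c₀ c) (K := K + W) (D.adj v)
    (fun e he => ((h₀ e.1).max (h e.1)).oplus (hW e he)) none (by simp)
  cases hf : (D.adj v).foldl
    (fun acc e => (WMPAlgo.improve (D.owner v) acc (edgeValue c₀ c e)).val) none with
  | none => simp [Bounded]
  | some y => exact this y hf

theorem bounded_initTable (T : V → Bool) (K : ℕ) (v : V) : Bounded K (initTable T v) := by
  intro z hz
  obtain ⟨-, rfl⟩ := initTable_eq_some hz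
  simp

theorem bounded_table {W : ℕ} (hW : ∀ v, ∀ e ∈ D.adj v, e.2.natAbs ≤ W) (T : V → Bool) (l : ℕ)
    (v : V) : Bounded (l * W) (table D T l v) := by
  induction l generalizing v with
  | zero => exact bounded_initTable T _ v
  | succ l ih =>
    rw [Nat.succ_mul]
    exact bounded_bestEdge (fun v => bounded_initTable T _ v) ih (hW v)

theorem natAbs_le_maxWeight (hD : D.Represents G) (v : V) : ∀ e ∈ D.adj v,
    e.2.natAbs ≤ G.maxWeight := by
  rintro ⟨u, x⟩ he
  obtain ⟨h1, rfl⟩ := (hD.mem_adj v u x).1 he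
  exact G.abs_weight_le h1

theorem atLeast_edgeValue {T : V → Bool} {l θ : ℕ} {u : V} {x : ℤ}
    (hl : ∀ v, Bounded (l * G.maxWeight) (table D T l v)) :
    AtLeast (edgeValue (initTable T) (table D T l) (u, x)) θ ↔
      (T u = true ∧ (θ : ℤ) ≤ x) ∨ AtLeast (table D T l u) ((θ : ℤ) - x).toNat := by
  rw [edgeValue, atLeast_oplus (max_nonneg (fun z hz => ((bounded_initTable T 0 u) z hz).1)
    fun z hz => (hl u z hz).1), atLeast_max]
  refine or_congr_left ?_
  constructor
  · rintro ⟨z, h1, h2⟩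
    obtain ⟨h3, rfl⟩ := initTable_eq_some h1
    exact ⟨h3, by omega⟩
  · rintro ⟨h1, h2⟩
    exact ⟨0, by simp [initTable, h1], by omega⟩

theorem atLeast_table (hD : D.Represents G) (T : V → Bool) (l : ℕ) (v : V) (θ : ℕ) :
    AtLeast (table D T (l + 1) v) θ ↔ G.Force {v | T v = true} (l + 1) v θ := by
  induction l using Nat.strong_induction_on generalizing v θ with
  | _ l ih =>
    have hedge : ∀ u x, (u, x) ∈ D.adj v →
        (AtLeast (edgeValue (initTable T) (table D T l) (u, x)) θ ↔
        G.Advances {v | T v = true} (G.Force {v | T v = true} l) v θ u) := by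
      intro u x hux
      obtain ⟨hu, rfl⟩ := (hD.mem_adj v u x).1 hux
      rw [atLeast_edgeValue (bounded_table (natAbs_le_maxWeight hD) T l)]
      cases l with
      | zero =>
        -- for `l = 0` the second case only repeats the first one
        constructor
        · rintro (h | ⟨z, h1, h2⟩)
          · exact Or.inl h
          · obtain ⟨h3, rfl⟩ := initTable_eq_some h1
            exact Or.inl ⟨h3, by omega⟩
        · rintro (h | h)
          exacts [Or.inl h, h.elim]
      | succ l => exact or_congr Iff.rfl (ih l (Nat.lt_succ_self l) u _)
    cases hv : G.owner v with
    | one =>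
      rw [Game.force_succ_one _ hv]
      refine (atLeast_bestEdge_one (by rw [hD.owner_eq, hv])).trans ?_
      constructor
      · rintro ⟨⟨u, x⟩, he, h⟩
        exact ⟨u, ((hD.mem_adj v u x).1 he).1, (hedge u x he).1 h⟩
      · rintro ⟨u, hu, h⟩
        have he := (hD.mem_adj v u _).2 ⟨hu, rfl⟩
        exact ⟨_, he, (hedge u _ he).2 h⟩
    | two =>
      rw [Game.force_succ_two _ hv]
      obtain ⟨v', hv'⟩ := G.no_deadlock v
      refine (atLeast_bestEdge_two (by rw [hD.owner_eq, hv])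
        (List.ne_nil_of_mem ((hD.mem_adj v v' _).2 ⟨hv', rfl⟩))).trans ?_
      constructor
      · intro h u hu
        have he := (hD.mem_adj v u _).2 ⟨hu, rfl⟩
        exact (hedge u _ he).1 (h _ he)
      · rintro h ⟨u, x⟩ he
        exact (hedge u x he).2 (h u ((hD.mem_adj v u x).1 he).1)

theorem val_sameSet (hD : D.Represents G) (A B : V → Bool) :
    (sameSet D A B).val = true ↔ A = B := by
  have h : ∀ (l : List V) (r : Bool), (l.foldl (fun r v => r && (A v == B v)) r) = true ↔
      r = true ∧ ∀ v ∈ l, A v = B v := by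
    intro l
    induction l with
    | nil => simp
    | cons a l ih => intro r; rw [List.foldl_cons, ih]; simp [and_assoc]
  rw [sameSet, val_forEach]
  refine (h D.verts true).trans ?_
  simp only [true_and, funext_iff]
  exact forall_congr' fun v => by simp [hD.mem_verts v]

theorem setOf_true_injective : Function.Injective fun A : V → Bool => {v | A v = true} := by
  intro A B h
  funext v
  have : A v = true ↔ B v = true := Set.ext_iff.1 h v
  exact Bool.eq_iff_iff.2 this

theorem val_addBit_verts_aux (l : List V) (acc : List (V × Bool)) :
    l.foldl (fun l v => (v, true) :: (v, false) :: l) acc =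
      (l.flatMap fun v => [(v, false), (v, true)]).reverse ++ acc := by
  induction l generalizing acc with
  | nil => rfl
  | cons v l ih => rw [List.foldl_cons, ih]; simp

theorem foldl_cons_eq_reverse_map {α β : Type} (g : α → β) (l : List α) (acc : List β) :
    l.foldl (fun acc e => g e :: acc) acc = (l.map g).reverse ++ acc := by
  induction l generalizing acc with
  | nil => rfl
  | cons a l ih => rw [List.foldl_cons, ih]; simp

/-- If the iteration of `F` becomes stable in time, then `repeatUntilStable` finds its limit. -/
theorem repeatUntilStable_correct (hD : D.Represents G) {step : (V → Bool) → Timed (V → Bool)}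
    {F : Set V → Set V} (hF : ∀ A, {v | (step A).val v = true} = F {v | A v = true}) {k n : ℕ}
    (hkn : k < n) (A : V → Bool)
    (hk : F (F^[k] {v | A v = true}) = F^[k] {v | A v = true}) :
    {v | (repeatUntilStable D step n A).val v = true} = F^[k] {v | A v = true} := by
  induction n generalizing k A with
  | zero => omega
  | succ n ih =>
    simp only [repeatUntilStable, val_bind]
    by_cases h : (sameSet D (step A).val A).val = true
    · have hA := hF A
      rw [if_pos h, val_pure, (val_sameSet hD _ _).1 h] at *
      rw [(val_sameSet hD _ _).1 h] at hA
      rw [Function.iterate_fixed hA.symm]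
    · rw [if_neg h]
      cases k with
      | zero =>
        refine absurd ((val_sameSet hD _ _).2 (setOf_true_injective ?_)) h
        exact (hF A).trans hk
      | succ k =>
        rw [Function.iterate_succ_apply, ← hF] at hk ⊢
        exact ih (by omega) _ hk

variable [DecidableEq V]

theorem val_icwEnd_step (hD : D.Represents G) (T : V → Bool) (l : ℕ) :
    (do
      let a ← newArray D.verts none
      forEach D.verts a fun a v => do
        let x ← bestEdge D (initTable T) (table D T l) v
        write a v x : Timed (V → Option ℤ)).val = table D T (l + 1) := by
  rw [val_bind]
  exact val_forEach_write hD.mem_verts _ fun a v => rfl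

theorem val_icwEnd_loop (hD : D.Represents G) (T : V → Bool) (lam : ℕ) :
    ((List.range lam).foldl (fun c _ => (do
      let a ← newArray D.verts none
      forEach D.verts a fun a v => do
        let x ← bestEdge D (initTable T) c v
        write a v x : Timed (V → Option ℤ)).val) (initTable T)) = table D T lam := by
  induction lam with
  | zero => rfl
  | succ l ih =>
    rw [List.range_succ, List.foldl_append, List.foldl_cons, List.foldl_nil, ih]
    exact val_icwEnd_step hD T l

theorem val_icwEnd_init (hD : D.Represents G) (T : V → Bool) :
    (forEach D.verts (newArray D.verts none).val fun a v => do
      let t ← read T v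
      if t then write a v (some 0) else write a v none : Timed (V → Option ℤ)).val =
      initTable T := by
  refine val_forEach_write hD.mem_verts _ fun a v => ?_
  simp only [val_bind, val_read, initTable]
  by_cases h : T v = true <;> simp [h]

theorem val_icwEnd (hD : D.Represents G) (lam : ℕ) (T : V → Bool) (v : V) :
    (icwEnd D lam T).val v = (isNonneg (table D T lam v)).val := by
  simp only [icwEnd, val_bind]
  rw [val_icwEnd_init hD, val_forEach (List.range lam), val_icwEnd_loop hD]
  have h := val_forEach_write hD.mem_verts (newArray D.verts false).val
    (f := fun r v => do
      let x ← read (table D T lam) v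
      let b ← isNonneg x
      write r v b) (g := fun v => (isNonneg (table D T lam v)).val) fun a v => rfl
  exact congrFun h v

theorem icwEnd_correct (hD : D.Represents G) {lam : ℕ} (hlam : 0 < lam) (T : V → Bool) :
    {v | (icwEnd D lam T).val v = true} = G.icw lam {v | T v = true} := by
  ext v
  obtain ⟨l, rfl⟩ := Nat.exists_eq_succ_of_ne_zero hlam.ne'
  refine Iff.trans ?_ (atLeast_table hD T l v 0)
  rw [Set.mem_ofPred_eq, val_icwEnd hD]
  unfold AtLeast isNonneg
  cases table D T (l + 1) v <;> simp

theorem val_union (hD : D.Represents G) (A B : V → Bool) (v : V) :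
    (union D A B).val v = (A v || B v) := by
  have h := val_forEach_write hD.mem_verts (newArray D.verts false).val
    (f := fun r v => do
      let a ← read A v
      let b ← read B v
      let c ← Timed.or a b
      write r v c) (g := fun v => A v || B v) fun a v => rfl
  exact congrFun h v

theorem union_correct (hD : D.Represents G) (A B : V → Bool) :
    {v | (union D A B).val v = true} = {v | A v = true} ∪ {v | B v = true} := by
  ext v
  rw [Set.mem_ofPred_eq, val_union hD, Bool.or_eq_true]
  rfl

theorem length_verts [Fintype V] (hD : D.Represents G) : D.verts.length = Fintype.card V := by
  rw [← List.toFinset_card_of_nodup hD.verts_nodup, ← Finset.card_univ]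
  congr 1
  ext v
  simp [hD.mem_verts v]

theorem gdEnd_correct [Fintype V] (hD : D.Represents G) {lam : ℕ} (hlam : 0 < lam) (X : V → Bool) :
    {v | (gdEnd D lam X).val v = true} = G.gdSet lam {v | X v = true} := by
  refine repeatUntilStable_correct hD (F := fun Y => Y ∪ G.icw lam Y) (fun A => ?_)
    (by rw [length_verts hD]; omega) X (G.union_icw_gdSet lam _)
  rw [val_bind, union_correct hD, icwEnd_correct hD hlam]

/-! ### The game with an added bit -/

theorem val_addBit_verts (D : GameData V) (U : V → Bool) : (addBit D U).val.verts =
    (D.verts.flatMap fun v => [(v, false), (v, true)]).reverse := by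
  have h : (addBit D U).val.verts = (forEach D.verts [] fun l v => do
    let l' ← push (v, false) l
    push (v, true) l').val := rfl
  rw [h, val_forEach]
  exact (val_addBit_verts_aux _ _).trans (List.append_nil _)

theorem mem_addBit_verts (hD : D.Represents G) (U : V → Bool) (x : V × Bool) :
    x ∈ (addBit D U).val.verts := by
  obtain ⟨v, b⟩ := x
  rw [val_addBit_verts, List.mem_reverse, List.mem_flatMap]
  exact ⟨v, hD.mem_verts v, by cases b <;> simp⟩

theorem val_addBit_adj (hD : D.Represents G) (U : V → Bool) (x : V × Bool) :
    (addBit D U).val.adj x = ((D.adj x.1).map fun e => ((e.1, x.2 || !U e.1), e.2)).reverse := by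
  have h : (addBit D U).val.adj = (forEach (addBit D U).val.verts
      (newArray (addBit D U).val.verts []).val fun a x => do
    let es ← read D.adj x.1
    let es' ← forEach es [] fun l e => do
      let u ← read U e.1
      let n ← Timed.not u
      let b ← Timed.or x.2 n
      tick (bits (some e.2))
      push ((e.1, b), e.2) l
    write a x es').val := rfl
  rw [h, val_forEach_write (mem_addBit_verts hD U)
    (g := fun x => ((D.adj x.1).map fun e => ((e.1, x.2 || !U e.1), e.2)).reverse) _ fun a x => ?_]
  · simp only [val_bind, val_read, val_write, val_forEach, val_not, val_or, val_push]
    congr 1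
    exact (foldl_cons_eq_reverse_map _ _ _).trans (List.append_nil _)

theorem addBit_represents (hD : D.Represents G) (U : V → Bool) :
    (addBit D U).val.Represents (G.addBit U) where
  verts_nodup := by
    rw [val_addBit_verts, List.nodup_reverse, List.nodup_flatMap]
    refine ⟨by simp, hD.verts_nodup.imp fun {a b} hab => ?_⟩
    simp [Function.onFun, List.Disjoint, hab]
  mem_verts := mem_addBit_verts hD U
  owner_eq := by
    have h : (addBit D U).val.owner = (forEach (addBit D U).val.verts
        (newArray (addBit D U).val.verts Player.one).val fun o x => do
      let p ← read D.owner x.1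
      write o x p).val := rfl
    rw [h, val_forEach_write (mem_addBit_verts hD U) _ fun a x => rfl]
    funext x
    rw [hD.owner_eq]
    rfl
  adj_nodup x := by
    rw [val_addBit_adj hD, List.nodup_reverse]
    refine (hD.adj_nodup x.1).map fun a b h => ?_
    simp only [Prod.mk.injEq] at h
    exact Prod.ext h.1.1 h.2
  mem_adj x y z := by
    obtain ⟨u, b⟩ := y
    rw [val_addBit_adj hD, List.mem_reverse, List.mem_map, Game.mem_addBit_edges]
    constructor
    · rintro ⟨⟨u, z⟩, he, h⟩
      simp only [Prod.mk.injEq] at h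
      obtain ⟨⟨rfl, rfl⟩, rfl⟩ := h
      have := (hD.mem_adj _ _ _).1 he
      exact ⟨⟨this.1, rfl⟩, this.2⟩
    · rintro ⟨⟨h1, h2⟩, h3⟩
      refine ⟨(u, z), (hD.mem_adj _ _ _).2 ⟨h1, h3⟩, ?_⟩
      simp only at h2
      rw [h2]

theorem endAlg_correct (hD : D.Represents G) {lam : ℕ} (hlam : 0 < lam) (U R Z : V → Bool) :
    {v | (endAlg D lam U R Z).val v = true} =
      G.endSet lam U {v | R v = true} {v | Z v = true} := by
  have hD' := addBit_represents hD U
  have hT : (forEach (addBit D U).val.verts (newArray (addBit D U).val.verts false).val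
      fun t x => do
      let r ← read R x.1
      let z ← read Z x.1
      let n ← Timed.not x.2
      let a ← Timed.and n z
      let b ← Timed.or r a
      write t x b).val = fun x => R x.1 || (!x.2 && Z x.1) :=
    val_forEach_write hD'.mem_verts _ fun a x => rfl
  have hS := icwEnd_correct hD' hlam fun x => R x.1 || (!x.2 && Z x.1)
  ext v
  simp only [endAlg, val_bind]
  rw [hT, Set.mem_ofPred_eq, val_forEach_write hD.mem_verts _ fun a v => rfl]
  refine (Set.ext_iff.1 hS (v, !U v)).trans ?_
  have hset : {x : V × Bool | (R x.1 || (!x.2 && Z x.1)) = true} =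
      Game.endTarget {v | R v = true} {v | Z v = true} := by
    ext x
    simp [Game.endTarget, and_comm]
  rw [hset]
  rfl

theorem objF_correct [Fintype V] (hD : D.Represents G) {lam : ℕ} (hlam : 0 < lam)
    (U X : V → Bool) :
    {v | (objF D lam U X).val v = true} = G.fSet lam U {v | X v = true} := by
  have h := repeatUntilStable_correct hD
    (F := fun Z => {v | X v = true} ∪ G.endSet lam U (G.gdSet lam {v | X v = true}) Z)
    (step := fun Z => do
      let T ← endAlg D lam U (gdEnd D lam X).val Z
      union D X T) (fun A => ?_)
    (k := Fintype.card V) (n := D.verts.length + 1) (by rw [length_verts hD]; omega)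
    (newArray D.verts true).val ?_
  · refine h.trans ?_
    have : {v | (newArray D.verts true).val v = true} = Set.univ := by
      ext v; simp [newArray]
    rw [this]
    rfl
  · rw [val_bind, union_correct hD, endAlg_correct hD hlam, gdEnd_correct hD hlam]
  · have : {v | (newArray D.verts true).val v = true} = Set.univ := by
      ext v; simp [newArray]
    rw [this]
    exact G.union_endSet_fSet lam U _

theorem wmpCoBuchi_correct [Fintype V] (hD : D.Represents G) {lam : ℕ} (hlam : 0 < lam)
    (U : V → Bool) :
    {v | (wmpCoBuchi D lam U).val v = true} = G.winSet lam U := by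
  have hempty : {v | (newArray D.verts false).val v = true} = ∅ := by
    ext v; simp [newArray]
  have h := repeatUntilStable_correct hD (F := fun X => X ∪ G.fSet lam U X)
    (step := fun X => do
      let Y ← objF D lam U X
      union D X Y) (fun A => ?_)
    (k := Fintype.card V) (n := D.verts.length + 1) (by rw [length_verts hD]; omega)
    (newArray D.verts false).val (by rw [hempty]; exact G.union_fSet_winSet lam U)
  · refine h.trans ?_
    rw [hempty]
    rfl
  · rw [val_bind, union_correct hD, objF_correct hD hlam]

end WMPAlgo

/-! ### Running times -/

namespace Timed

theorem time_forEach_le {α β : Type} {l : List α} {b : β} {f : β → α → Timed β}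
    (Inv : ℕ → β → Prop) (g : α → ℕ) (h : ∀ i b a, i < l.length → a ∈ l → Inv i b →
      Inv (i + 1) (f b a).val ∧ (f b a).time ≤ g a) (hb : Inv 0 b) :
    (forEach l b f).time ≤ (l.map fun a => g a + 1).sum + 1 := by
  induction l generalizing b Inv with
  | nil => exact le_rfl
  | cons a l ih =>
    obtain ⟨h1, h2⟩ := h 0 b a (Nat.succ_pos _) List.mem_cons_self hb
    have h3 := ih (b := (f b a).val) (fun i => Inv (i + 1)) (fun i b' a' hi ha' hb' =>
      h (i + 1) b' a' (Nat.succ_lt_succ hi) (List.mem_cons_of_mem _ ha') hb') h1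
    simp only [forEach, time_bind, time_tick, List.map_cons, List.sum_cons]
    omega

theorem time_forEach_le_mul {α β : Type} {l : List α} {b : β} {f : β → α → Timed β} {t : ℕ}
    (h : ∀ b, ∀ a ∈ l, (f b a).time ≤ t) : (forEach l b f).time ≤ l.length * (t + 1) + 1 := by
  refine (time_forEach_le (fun _ _ => True) (fun _ => t) (fun _ b a _ ha _ => ⟨trivial, h b a ha⟩)
    trivial).trans ?_
  simp

end Timed

namespace WMPAlgo

open Timed

variable {V : Type} {D : GameData V} {G : Game V}

theorem bits_some_le {K : ℕ} {x : ℤ} (h : x.natAbs ≤ K) : bits (some x) ≤ K.size + 1 :=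
  Nat.succ_le_succ (Nat.size_le_size h)

theorem Bounded.bits_le {K : ℕ} {a : Option ℤ} (h : Bounded K a) : bits a ≤ K.size + 1 := by
  cases a with
  | none => exact Nat.succ_le_succ (Nat.zero_le _)
  | some x =>
    obtain ⟨h1, h2⟩ := h x rfl
    exact bits_some_le (by omega)

theorem time_bestEdge_le {K L W : ℕ} {c₀ c : V → Option ℤ} {v : V} (hK : L + W ≤ K)
    (h₀ : ∀ v, Bounded L (c₀ v)) (h : ∀ v, Bounded L (c v)) (hW : ∀ e ∈ D.adj v, e.2.natAbs ≤ W) :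
    (bestEdge D c₀ c v).time ≤ 3 + (D.adj v).length * (9 * (K.size + 1)) := by
  simp only [bestEdge, time_bind, time_read, val_read, time_pure]
  have key := time_forEach_le (l := D.adj v) (b := none)
    (f := fun acc e => do
      let a ← read c₀ e.1
      let b ← read c e.1
      let m ← Timed.max a b
      let x ← oplus (some e.2) m
      improve (D.owner v) acc x)
    (fun _ acc => ∀ y, acc = some y → Bounded K y) (fun _ => 2 + 6 * (K.size + 1)) ?_ (by simp)
  · rw [List.map_const', List.sum_replicate, smul_eq_mul] at key
    refine (Nat.add_le_add_left (Nat.add_le_add_left (Nat.add_le_add_right key 0) 1) 1).trans ?_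
    have : (D.adj v).length * (2 + 6 * (K.size + 1) + 1) ≤
        (D.adj v).length * (9 * (K.size + 1)) := Nat.mul_le_mul_left _ (by omega)
    omega
  · intro i acc e _ he hacc
    have hm := (h₀ e.1).max (h e.1)
    have hx : Bounded K (edgeValue c₀ c e) := (hm.oplus (hW e he)).mono hK
    refine ⟨Bounded.improve hacc hx, ?_⟩
    have hL : ∀ {a}, Bounded L a → bits a ≤ K.size + 1 := fun ha => (ha.mono (by omega)).bits_le
    have himp : (improve (D.owner v) acc (edgeValue c₀ c e)).time ≤ 2 * (K.size + 1) := by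
      cases acc with
      | none =>
        have : (improve (D.owner v) none (edgeValue c₀ c e)).time = 1 := by
          cases D.owner v <;> rfl
        omega
      | some y =>
        have : (improve (D.owner v) (some y) (edgeValue c₀ c e)).time =
            bits y + bits (edgeValue c₀ c e) := by
          cases D.owner v <;> rfl
        have := (hacc y rfl).bits_le
        have := hx.bits_le
        omega
    have h1 : (Timed.max (c₀ e.1) (c e.1)).time ≤ 2 * (K.size + 1) := by
      have h3 : (Timed.max (c₀ e.1) (c e.1)).time = bits (c₀ e.1) + bits (c e.1) := rfl
      have := hL (h₀ e.1)
      have := hL (h e.1)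
      omega
    have h2 : (oplus (some e.2) (Timed.max (c₀ e.1) (c e.1)).val).time ≤ 2 * (K.size + 1) := by
      have h3 : (oplus (some e.2) (Timed.max (c₀ e.1) (c e.1)).val).time =
        bits (some e.2) + bits (Timed.max (c₀ e.1) (c e.1)).val := rfl
      have := hL hm
      have := bits_some_le (K := K) ((hW e he).trans (by omega))
      omega
    simp only [time_bind, time_read, val_read]
    change 1 + (1 + (_ + (_ + (improve (D.owner v) acc (edgeValue c₀ c e)).time))) ≤ _
    omega

theorem length_adj [DecidableEq V] (hD : D.Represents G) (v : V) :
    (D.adj v).length = (G.edges.filter fun e => e.1 = v).card := by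
  classical
  rw [← List.toFinset_card_of_nodup (hD.adj_nodup v)]
  refine Finset.card_bij' (fun e _ => (v, e.1)) (fun e _ => (e.2, G.w v e.2)) ?_ ?_ ?_ ?_
  · rintro ⟨u, x⟩ he
    have := (hD.mem_adj v u x).1 (List.mem_toFinset.1 he)
    simpa using this.1
  · rintro ⟨u, u'⟩ he
    obtain ⟨h1, rfl⟩ := Finset.mem_filter.1 he
    exact List.mem_toFinset.2 ((hD.mem_adj _ _ _).2 ⟨h1, rfl⟩)
  · rintro ⟨u, x⟩ he
    have := (hD.mem_adj v u x).1 (List.mem_toFinset.1 he)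
    simp [this.2]
  · rintro ⟨u, u'⟩ he
    obtain ⟨h1, rfl⟩ := Finset.mem_filter.1 he
    rfl

variable [DecidableEq V]

theorem sum_length_adj [Fintype V] (hD : D.Represents G) :
    (D.verts.map fun v => (D.adj v).length).sum = G.edges.card := by
  classical
  rw [← List.sum_toFinset _ hD.verts_nodup,
    Finset.card_eq_sum_card_fiberwise (f := Prod.fst) (t := D.verts.toFinset)
      fun e _ => List.mem_toFinset.2 (hD.mem_verts e.1)]
  exact Finset.sum_congr rfl fun v _ => length_adj hD v

theorem sum_map_adj_mul_add [Fintype V] (hD : D.Represents G) (a b : ℕ) :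
    (D.verts.map fun v => (D.adj v).length * a + b).sum =
      G.edges.card * a + Fintype.card V * b := by
  rw [List.sum_map_add, List.sum_map_mul_right, sum_length_adj hD, List.map_const',
    List.sum_replicate, smul_eq_mul, length_verts hD]

omit [DecidableEq V] in
theorem time_sameSet_le (D : GameData V) (A B : V → Bool) :
    (sameSet D A B).time ≤ 5 * D.verts.length + 1 := by
  refine (time_forEach_le_mul (t := 4) fun r v _ => le_rfl).trans ?_
  omega

section Time

variable [Fintype V] (hD : D.Represents G) {lam W : ℕ}

include hD

theorem time_icwEnd_step_le (hW : G.maxWeight ≤ W) (T : V → Bool) {l : ℕ} (hl : l < lam) :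
    (do
      let a ← newArray D.verts none
      forEach D.verts a fun a v => do
        let x ← bestEdge D (initTable T) (table D T l) v
        write a v x : Timed (V → Option ℤ)).time ≤
      6 * Fintype.card V + 9 * (G.edges.card * ((lam * W).size + 1)) + 2 := by
  have hwt := fun v e he => (natAbs_le_maxWeight hD v e he).trans hW
  simp only [time_bind, time_newArray]
  rw [length_verts hD]
  have key := time_forEach_le (l := D.verts) (b := (newArray D.verts none).val)
    (f := fun a v => do
      let x ← bestEdge D (initTable T) (table D T l) v
      write a v x)
    (fun _ _ => True) (fun v => 4 + (D.adj v).length * (9 * ((lam * W).size + 1)))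
    (fun _ a v _ _ _ => ⟨trivial, ?_⟩) trivial
  · have hsum := sum_map_adj_mul_add hD (9 * ((lam * W).size + 1)) 5
    rw [show (fun v => 4 + (D.adj v).length * (9 * ((lam * W).size + 1)) + 1) =
      fun v => (D.adj v).length * (9 * ((lam * W).size + 1)) + 5 by funext; omega, hsum] at key
    have : G.edges.card * (9 * ((lam * W).size + 1)) =
      9 * (G.edges.card * ((lam * W).size + 1)) := by ring
    omega
  · have hK : l * W + W ≤ lam * W := by
      rw [← Nat.succ_mul]
      exact Nat.mul_le_mul_right _ hl
    have := time_bestEdge_le hK (fun v => bounded_initTable T _ v) (bounded_table hwt T l) (hwt v)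
    simp only [time_bind, time_write]
    omega

theorem time_icwEnd_le [Nonempty V] (hlam : 0 < lam) (hW : G.maxWeight ≤ W) (T : V → Bool) :
    (icwEnd D lam T).time ≤
      30 * (lam * (Fintype.card V + G.edges.card) * ((lam * W).size + 1)) := by
  have hwt := fun v e he => (natAbs_le_maxWeight hD v e he).trans hW
  set B := (lam * W).size + 1 with hB
  have hN : 0 < Fintype.card V := Fintype.card_pos
  simp only [icwEnd, time_bind, time_newArray]
  rw [val_icwEnd_init hD, val_forEach (List.range lam), val_icwEnd_loop hD]
  have h1 : (forEach D.verts (newArray D.verts none).val fun a v => do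
      let t ← read T v
      if t then write a v (some 0) else write a v none : Timed (V → Option ℤ)).time ≤ _ :=
    time_forEach_le_mul (t := 2) fun a v _ => by
      simp only [time_bind, time_read]
      split_ifs <;> rfl
  have h2 := time_forEach_le (l := List.range lam) (b := initTable T)
    (f := fun c _ => do
      let a ← newArray D.verts none
      forEach D.verts a fun a v => do
        let x ← bestEdge D (initTable T) c v
        write a v x)
    (fun i c => c = table D T i)
    (fun _ => 6 * Fintype.card V + 9 * (G.edges.card * B) + 2)
    (fun i c _ hi _ hc => by
      subst hc
      rw [List.length_range] at hi
      exact ⟨val_icwEnd_step hD T i, time_icwEnd_step_le hD hW T hi⟩) rfl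
  have h3 : (forEach D.verts (newArray D.verts false).val fun r v => do
      let x ← read (table D T lam) v
      let b ← isNonneg x
      write r v b).time ≤ _ :=
    time_forEach_le_mul (t := 2 + B) fun a v _ => by
      have h4 : (isNonneg (table D T lam v)).time = bits (table D T lam v) := rfl
      have h5 := (bounded_table hwt T lam v).bits_le
      simp only [time_bind, time_read, val_read, time_write, h4]
      omega
  rw [List.map_const', List.sum_replicate, smul_eq_mul, List.length_range] at h2
  rw [length_verts hD] at h1 h3 ⊢
  refine (Nat.add_le_add_left (Nat.add_le_add h1 (Nat.add_le_add h2
    (Nat.add_le_add_left h3 _))) _).trans ?_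
  have hB1 : 1 ≤ B := by omega
  have e1 : Fintype.card V * 1 * 1 ≤ Fintype.card V * lam * B := by gcongr; omega
  have e2 : Fintype.card V * lam * 1 ≤ Fintype.card V * lam * B := by gcongr
  have e3 : Fintype.card V * 1 * B ≤ Fintype.card V * lam * B := by gcongr; omega
  have e4 : 1 * lam * 1 ≤ Fintype.card V * lam * 1 := by gcongr; omega
  nlinarith [Nat.zero_le (lam * G.edges.card * B)]

theorem time_union_le (A B : V → Bool) : (union D A B).time ≤ 6 * Fintype.card V + 2 := by
  have h : (forEach D.verts (newArray D.verts false).val fun r v => do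
      let a ← read A v
      let b ← read B v
      let c ← Timed.or a b
      write r v c).time ≤ _ := time_forEach_le_mul (t := 4) fun r v _ => le_rfl
  simp only [union, time_bind, time_newArray]
  rw [length_verts hD] at h ⊢
  omega

theorem time_repeatUntilStable_le {step : (V → Bool) → Timed (V → Bool)} {t : ℕ}
    (ht : ∀ A, (step A).time ≤ t) (n : ℕ) (A : V → Bool) :
    (repeatUntilStable D step n A).time ≤ n * (t + 5 * Fintype.card V + 1) := by
  induction n generalizing A with
  | zero => exact le_of_eq (by rw [Nat.zero_mul]; rfl)
  | succ n ih =>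
    simp only [repeatUntilStable, time_bind]
    have h1 := ht A
    have h2 := time_sameSet_le D (step A).val A
    have h3 := ih (step A).val
    rw [length_verts hD] at h2
    rw [Nat.succ_mul]
    split_ifs
    · rw [time_pure]; omega
    · omega

theorem time_addBit_le (hW : G.maxWeight ≤ W) (U : V → Bool) :
    (addBit D U).time ≤ 25 * Fintype.card V + 12 * (G.edges.card * (W.size + 1)) + 5 := by
  have hD' := addBit_represents hD U
  have hN : (addBit D U).val.verts.length = 2 * Fintype.card V := by
    rw [length_verts hD', Fintype.card_prod, Fintype.card_bool, mul_comm]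
  have h1 : (forEach D.verts [] fun l v => do
      let l' ← push (v, false) l
      push (v, true) l').time ≤ _ := time_forEach_le_mul (t := 2) fun r v _ => le_rfl
  have h2 : (forEach (addBit D U).val.verts (newArray (addBit D U).val.verts Player.one).val
      fun o x => do
        let p ← read D.owner x.1
        write o x p).time ≤ _ := time_forEach_le_mul (t := 2) fun r v _ => le_rfl
  have h3 := time_forEach_le (l := (addBit D U).val.verts)
    (b := (newArray (addBit D U).val.verts []).val) (f := fun a x => do
      let es ← read D.adj x.1
      let es' ← forEach es [] fun l e => do
        let u ← read U e.1
        let n ← Timed.not u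
        let b ← Timed.or x.2 n
        tick (bits (some e.2))
        push ((e.1, b), e.2) l
      write a x es')
    (fun _ _ => True) (fun x => 3 + (D.adj x.1).length * (5 + (W.size + 1)))
    (fun _ a x _ _ _ => ⟨trivial, ?_⟩) trivial
  · have hsum := sum_map_adj_mul_add hD' (5 + (W.size + 1)) 4
    have hlen : ∀ x, ((addBit D U).val.adj x).length = (D.adj x.1).length := by
      intro x
      rw [val_addBit_adj hD, List.length_reverse, List.length_map]
    simp only [hlen] at hsum
    rw [show (fun x : V × Bool => 3 + (D.adj x.1).length * (5 + (W.size + 1)) + 1) =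
      fun x => (D.adj x.1).length * (5 + (W.size + 1)) + 4 by funext; omega, hsum,
      Fintype.card_prod, Fintype.card_bool] at h3
    have hE : (G.addBit U).edges.card * (5 + (W.size + 1)) ≤
        2 * G.edges.card * (6 * (W.size + 1)) :=
      Nat.mul_le_mul (G.card_addBit_edges_le U) (by omega)
    have hE' : 2 * G.edges.card * (6 * (W.size + 1)) = 12 * (G.edges.card * (W.size + 1)) := by
      ring
    have key : (addBit D U).time ≤ _ := Nat.add_le_add h1 (Nat.add_le_add_left (Nat.add_le_add h2
      (Nat.add_le_add_left (Nat.add_le_add_right h3 0) ((addBit D U).val.verts.length + 1)))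
      ((addBit D U).val.verts.length + 1))
    rw [hN, length_verts hD] at key
    omega
  · have h4 : (forEach (D.adj x.1) [] fun l e => do
        let u ← read U e.1
        let n ← Timed.not u
        let b ← Timed.or x.2 n
        tick (bits (some e.2))
        push ((e.1, b), e.2) l).time ≤ _ :=
      time_forEach_le_mul (t := 4 + (W.size + 1)) fun l e he => by
        have := bits_some_le ((natAbs_le_maxWeight hD x.1 e he).trans hW)
        simp only [time_bind, time_read, time_not, time_or, time_tick, time_push]
        omega
    simp only [time_bind, time_read, val_read, time_write]
    rw [show 4 + (W.size + 1) + 1 = 5 + (W.size + 1) by omega] at h4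
    omega

theorem time_endAlg_le [Nonempty V] (hlam : 0 < lam) (hW : G.maxWeight ≤ W) (U R Z : V → Bool) :
    (endAlg D lam U R Z).time ≤
      200 * (lam * (Fintype.card V + G.edges.card) * ((lam * W).size + 1)) := by
  have hD' := addBit_represents hD U
  have hN : (addBit D U).val.verts.length = 2 * Fintype.card V := by
    rw [length_verts hD', Fintype.card_prod, Fintype.card_bool, mul_comm]
  have h1 := time_addBit_le hD hW U
  have h2 : (forEach (addBit D U).val.verts (newArray (addBit D U).val.verts false).val
      fun t x => do
        let r ← read R x.1
        let z ← read Z x.1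
        let n ← Timed.not x.2
        let a ← Timed.and n z
        let b ← Timed.or r a
        write t x b).time ≤ _ := time_forEach_le_mul (t := 6) fun r v _ => le_rfl
  have h3 := time_icwEnd_le hD' hlam ((G.addBit_maxWeight_le U).trans hW)
    (forEach (addBit D U).val.verts (newArray (addBit D U).val.verts false).val
      fun t x => do
        let r ← read R x.1
        let z ← read Z x.1
        let n ← Timed.not x.2
        let a ← Timed.and n z
        let b ← Timed.or r a
        write t x b).val
  have h4 : ∀ S : V × Bool → Bool, (forEach D.verts (newArray D.verts false).val fun r v => do
      let u ← read U v
      let n ← Timed.not u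
      let s ← read S (v, n)
      write r v s).time ≤ _ := fun S => time_forEach_le_mul (t := 4) fun r v _ => le_rfl
  simp only [endAlg, time_bind, time_newArray]
  rw [hN] at h2 ⊢
  rw [length_verts hD] at h4 ⊢
  refine (Nat.add_le_add h1 (Nat.add_le_add_left (Nat.add_le_add h2 (Nat.add_le_add h3
    (Nat.add_le_add_left (h4 _) _))) _)).trans ?_
  rw [Fintype.card_prod, Fintype.card_bool]
  have hE := G.card_addBit_edges_le U
  have hpos : 0 < Fintype.card V := Fintype.card_pos
  have hsize : W.size ≤ (lam * W).size := Nat.size_le_size (Nat.le_mul_of_pos_left W hlam)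
  set B := (lam * W).size + 1 with hB
  have hB1 : 1 ≤ B := by omega
  have e1 : Fintype.card V * 1 * 1 ≤ Fintype.card V * lam * B := by gcongr; omega
  have e2 : G.edges.card * 1 * (W.size + 1) ≤ G.edges.card * lam * B :=
    Nat.mul_le_mul (Nat.mul_le_mul_left _ hlam) (by omega)
  have e3 : lam * (Fintype.card V * 2 + (G.addBit U).edges.card) * B ≤
      lam * (Fintype.card V * 2 + 2 * G.edges.card) * B := by gcongr
  nlinarith

theorem time_gdEnd_le [Nonempty V] (hlam : 0 < lam) (hW : G.maxWeight ≤ W) (X : V → Bool) :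
    (gdEnd D lam X).time ≤ (Fintype.card V + 1) *
      (50 * (lam * (Fintype.card V + G.edges.card) * ((lam * W).size + 1))) := by
  refine (time_repeatUntilStable_le hD (t := 30 * (lam * (Fintype.card V + G.edges.card) *
    ((lam * W).size + 1)) + (6 * Fintype.card V + 2)) (fun Y => ?_) _ X).trans ?_
  · rw [time_bind]
    exact Nat.add_le_add (time_icwEnd_le hD hlam hW Y) (time_union_le hD _ _)
  · rw [length_verts hD]
    refine Nat.mul_le_mul_left _ ?_
    have hpos : 0 < Fintype.card V := Fintype.card_pos
    have e1 : 1 * Fintype.card V * 1 ≤ lam * (Fintype.card V + G.edges.card) *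
        ((lam * W).size + 1) := by gcongr <;> omega
    omega

theorem time_objF_le [Nonempty V] (hlam : 0 < lam) (hW : G.maxWeight ≤ W) (U X : V → Bool) :
    (objF D lam U X).time ≤ (Fintype.card V + 1) *
      (300 * (lam * (Fintype.card V + G.edges.card) * ((lam * W).size + 1))) := by
  set P := lam * (Fintype.card V + G.edges.card) * ((lam * W).size + 1) with hP
  have hpos : 0 < Fintype.card V := Fintype.card_pos
  have e1 : 1 * Fintype.card V * 1 ≤ P := by rw [hP]; gcongr <;> omega
  have h1 := time_gdEnd_le hD hlam hW X
  have h2 := time_repeatUntilStable_le hD (t := 200 * P + (6 * Fintype.card V + 2))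
    (step := fun Z => do
      let T ← endAlg D lam U (gdEnd D lam X).val Z
      union D X T) (fun Z => by
        rw [time_bind]
        exact Nat.add_le_add (time_endAlg_le hD hlam hW _ _ _) (time_union_le hD _ _))
    (D.verts.length + 1) (newArray D.verts true).val
  simp only [objF, time_bind, time_newArray]
  rw [length_verts hD] at h2 ⊢
  refine (Nat.add_le_add h1 (Nat.add_le_add_left h2 _)).trans ?_
  rw [← hP]
  nlinarith

theorem time_wmpCoBuchi_le [Nonempty V] (hlam : 0 < lam) (hW : G.maxWeight ≤ W) (U : V → Bool) :
    (wmpCoBuchi D lam U).time ≤ 2000 * Fintype.card V ^ 2 *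
      (lam * (Fintype.card V + G.edges.card) * ((lam * W).size + 1)) := by
  set P := lam * (Fintype.card V + G.edges.card) * ((lam * W).size + 1) with hP
  set N := Fintype.card V with hN
  have hpos : 0 < N := Fintype.card_pos
  have e1 : 1 * N * 1 ≤ P := by rw [hP]; gcongr <;> omega
  have h2 := time_repeatUntilStable_le hD (t := (N + 1) * (300 * P) + (6 * N + 2))
    (step := fun X => do
      let Y ← objF D lam U X
      union D X Y) (fun X => by
        rw [time_bind]
        exact Nat.add_le_add (time_objF_le hD hlam hW _ _) (time_union_le hD _ _))
    (D.verts.length + 1) (newArray D.verts false).val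
  simp only [wmpCoBuchi, time_bind, time_newArray]
  rw [length_verts hD] at h2 ⊢
  refine (Nat.add_le_add_left h2 _).trans ?_
  -- all terms are at most multiples of `N ^ 2 * P`, as `1 ≤ N ≤ P`
  have h3 : (N + 1) * (300 * P) + (6 * N + 2) + 5 * N + 1 ≤ 700 * (N * P) := by nlinarith
  calc N + 1 + (N + 1) * ((N + 1) * (300 * P) + (6 * N + 2) + 5 * N + 1)
      ≤ 2 * (N * P) + (2 * N) * (700 * (N * P)) :=
        Nat.add_le_add (by nlinarith) (Nat.mul_le_mul (by omega) h3)
    _ ≤ 2000 * N ^ 2 * P := by nlinarith [Nat.mul_le_mul hpos (Nat.mul_le_mul hpos (le_refl P))]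

end Time

theorem size_le_clog_add_one (n : ℕ) : n.size ≤ Nat.clog 2 n + 1 := by
  rw [Nat.size_le]
  exact (Nat.le_pow_clog one_lt_two n).trans_lt
    (Nat.pow_lt_pow_right one_lt_two (Nat.lt_succ_self _))

end WMPAlgo

/-! ### Correctness, running time and memory -/

theorem mainTheorem7 :
    ∃ c : ℕ, ∀ (V : Type) [Fintype V] [DecidableEq V] [Nonempty V] (G : Game V)
      (lam : ℕ) (_hlam : 0 < lam) (U : Finset V),
      -- the algorithms are correct, and the main one runs within the time bound
      (∀ D : GameData V, D.Represents G →
        {v | (WMPAlgo.wmpCoBuchi D lam (fun u => decide (u ∈ U))).val v = true} =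
            G.winningSet .one (G.WMP lam ∩ G.CoBuchi ↑U) ∧
        (WMPAlgo.wmpCoBuchi D lam (fun u => decide (u ∈ U))).time ≤
            c * (lam * Fintype.card V ^ 2 * (Fintype.card V + G.edges.card) *
              max 1 (Nat.clog 2 (lam * G.maxWeight))) ∧
        ∀ X : Finset V,
          {v | (WMPAlgo.objF D lam (fun u => decide (u ∈ U)) (fun x => decide (x ∈ X))).val v
              = true} =
            G.winningSet .one (G.FObj lam ↑U ↑X)) ∧
      -- the two nested fixpoints
      IsLeast {X : Set V | G.winningSet .one (G.FObj lam ↑U X) = X}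
        (G.winningSet .one (G.WMP lam ∩ G.CoBuchi ↑U)) ∧
      (∀ X : Set V,
        IsGreatest {Z : Set V | X ∪ G.winningSet .one (G.EndObj lam ↑U X Z) = Z}
          (G.winningSet .one (G.FObj lam ↑U X))) ∧
      -- memory of player 1
      (∃ A : G.MooreMachine .one,
        A.size ≤ c * (lam ^ 2 * max 1 G.maxWeight * Fintype.card V ^ 2) ∧
        ∀ v ∈ G.winningSet .one (G.WMP lam ∩ G.CoBuchi ↑U),
          A.strategy.WinsFrom v (G.WMP lam ∩ G.CoBuchi ↑U)) ∧
      -- memory of player 2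
      (∃ A : G.MooreMachine .two,
        A.size ≤ c * (lam ^ 2 * max 1 G.maxWeight * Fintype.card V) ∧
        ∀ v ∈ G.winningSet .two (G.Plays \ (G.WMP lam ∩ G.CoBuchi ↑U)),
          A.strategy.WinsFrom v (G.Plays \ (G.WMP lam ∩ G.CoBuchi ↑U))) := by
  refine ⟨6000, fun V _ _ _ G lam hlam U => ?_⟩
  set u : V → Bool := fun v => decide (v ∈ U) with hu
  have hU : (↑U : Set V) = {v | u v = true} := by
    ext v
    simp [hu]
  have hN : 0 < Fintype.card V := Fintype.card_pos
  rw [hU]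
  simp only [Game.winningSet_WMP_inter_CoBuchi, Game.winningSet_FObj, Game.winningSet_EndObj]
  refine ⟨fun D hD => ⟨WMPAlgo.wmpCoBuchi_correct hD hlam u, ?_, fun X => ?_⟩,
    G.isLeast_winSet lam u, G.isGreatest_fSet lam u, ?_, ?_⟩
  · refine (WMPAlgo.time_wmpCoBuchi_le hD hlam le_rfl u).trans ?_
    have hclog := WMPAlgo.size_le_clog_add_one (lam * G.maxWeight)
    set M := max 1 (Nat.clog 2 (lam * G.maxWeight)) with hM
    have hB : (lam * G.maxWeight).size + 1 ≤ 3 * M := by omega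
    calc 2000 * Fintype.card V ^ 2 * (lam * (Fintype.card V + G.edges.card) *
          ((lam * G.maxWeight).size + 1))
        ≤ 2000 * Fintype.card V ^ 2 * (lam * (Fintype.card V + G.edges.card) * (3 * M)) := by gcongr
      _ = 6000 * (lam * Fintype.card V ^ 2 * (Fintype.card V + G.edges.card) * M) := by ring
  · have hX : (↑X : Set V) = {v | decide (v ∈ X) = true} := by
      ext v
      simp
    rw [hX]
    exact WMPAlgo.objF_correct hD hlam u _
  · refine ⟨G.attacker lam u (G.winTarget lam u), ?_, fun v hv => ?_⟩
    · rw [Game.attacker_size]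
      calc Fintype.card V * ((lam + 1) * 2) ≤ Fintype.card V * ((lam + lam) * 2) := by gcongr; omega
        _ = 4 * (lam * 1 * Fintype.card V) := by ring
        _ ≤ 6000 * (lam ^ 2 * max 1 G.maxWeight * Fintype.card V ^ 2) := by
          gcongr
          · omega
          · exact Nat.le_self_pow two_ne_zero _
          · exact le_max_left _ _
          · exact Nat.le_self_pow two_ne_zero _
    · exact Game.MooreMachine.winsFrom _ fun ρ hρ h0 => Game.mem_objective_of_attacker hρ (h0 ▸ hv)
  · refine ⟨G.defender lam u (G.fAvoid_antitone lam u (G.winSet lam u)) true, ?_, fun v hv => ?_⟩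
    · rw [Game.defender_size]
      set M := max 1 G.maxWeight with hM
      have h1 : lam * G.maxWeight + 1 ≤ 2 * (lam * M) := by
        have h2 : lam * G.maxWeight ≤ lam * M := Nat.mul_le_mul_left _ (le_max_right _ _)
        have h3 : 1 * 1 ≤ lam * M := Nat.mul_le_mul hlam (le_max_left _ _)
        omega
      have h4 : 1 * 1 * 1 ≤ lam ^ 2 * M * Fintype.card V :=
        Nat.mul_le_mul (Nat.mul_le_mul (Nat.pow_pos hlam) (le_max_left _ _)) hN
      calc Fintype.card V * ((lam + 1) * ((lam * G.maxWeight + 1) * 2)) + 1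
          ≤ Fintype.card V * ((lam + lam) * (2 * (lam * M) * 2)) +
            lam ^ 2 * M * Fintype.card V := by
            gcongr
            exact hlam
        _ = 9 * (lam ^ 2 * M * Fintype.card V) := by ring
        _ ≤ 6000 * (lam ^ 2 * M * Fintype.card V) := by gcongr; omega
    · refine Game.MooreMachine.winsFrom _ fun ρ hρ h0 => ⟨hρ.mem_plays, ?_⟩
      exact Game.notMem_objective_of_defender hρ
        (h0 ▸ Game.notMem_winSet_of_mem_winningSet_two hv)
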